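/- **Setting.** Let $\mathfrak{Lie}$ be the Lie operad over $\mathbb{Q}$ and let $\mathsf{Cat}_{\mathfrak{Lie}}$ be its PROP: the $\mathbb{Q}$-linear category with objects $\mathbb{N}$ and $$\mathsf{Cat}_{\mathfrak{Lie}}(m,n)=\bigoplus_{f:\{1,\dots,m\}\twoheadrightarrow\{1,\dots,n\}}\ \bigotimes_{i=1}^n\mathfrak{Lie}(f^{-1}(i)).$$ It is symmetric monoidal under addition of objects. Left (right) $\mathsf{Cat}_{\mathfrak{Lie}}$-modules are covariant (contravariant) $\mathbb{Q}$-linear functors from it to $\mathbb{Q}$-vector spaces. Let $\Sigma$ be the category of finite sets and bijections, with skeleton $\mathbb N$. The unit and the augmentation of the operad induce functors $\mathbb{Q}\Sigma\to\mathsf{Cat}_{\mathfrak{Lie}}\to\mathbb{Q}\Sigma$ whose composite is the identity; the augmentation kills all brackets. For $n\in\mathbb{N}$, regard $\mathbb{Q}\mathfrak{S}_n$ as a left $\mathbb{Q}\Sigma$-module supported on $n$ and, by restriction along the augmentation, as a left $\mathsf{Cat}_{\mathfrak{Lie}}$-module. For $M,N$ right $\mathbb{Q}\Sigma$-modules, $(M\odot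 N)(S)=\bigoplus_{S=S_1\sqcup S_2}M(S_1)\otimes N(S_2)$, the sum being over ordered decompositions. Let $\mathrm{sgn}_t$ be the signature representation of $\mathfrak{S}_t$, viewed as a right $\mathbb{Q}\Sigma$-module supported on $t$. The universal Chevalley–Eilenberg complex $\mathsf{CE}_{\mathfrak{Lie}}$ is the complex of $\mathsf{Cat}_{\mathfrak{Lie}}$-bimodules whose term of homological degree $t$, evaluated on $n$ for the left structure, is the right module $\mathsf{Cat}_{\mathfrak{Lie}}(-,n)\odot\Lambda^t(\mathfrak{Lie})$, that is, the quotient of $\mathsf{Cat}_{\mathfrak{Lie}}(-,n+t)$ by the relations $\sigma\psi=\mathrm{sgn}(\sigma)\psi$ for permutations $\sigma$ of the last $t$ outputs. A morphism $f:n\to n'$ acts on the left through $f\boxplus\mathrm{id}_t$. The differential from degree $t+1$ to degree $t$ is induced by $$m\otimes x_0\wedge\dots\wedge x_t\ \longmapsto\ \sum_{j}(-1)^j\Big(m\cdot x_j\otimes x_0\wedge\dots\widehat{x_j}\dots\wedge x_t+\sum_{i<j}m\otimes x_0\wedge\dots\wedge[x_i,x_j]\wedge\dots\widehat{x_j}\dots\wedge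 x_t\Big),$$ where $[x_i,x_j]$ stands in the place of $x_i$ and $m\cdot x$ denotes the diagonal right adjoint action on the first $n$ outputs, $(y_1\otimes\dots\otimes y_n)\cdot x=\sum_i y_1\otimes\dots\otimes[y_i,x]\otimes\dots\otimes y_n$. For $n\in\mathbb N$, the homology $H_*(\mathsf{CE}_{\mathfrak{Lie}}\otimes_{\mathsf{Cat}_{\mathfrak{Lie}}}\mathbb{Q}\mathfrak{S}_n)$ is a left $\mathsf{Cat}_{\mathfrak{Lie}}$-module in each degree, with a commuting right action of $\mathfrak{S}_n$ induced by the right regular action on $\mathbb{Q}\mathfrak{S}_n$. **Proposition.** Let $n,t\in\mathbb{N}$. 1. The left $\mathsf{Cat}_{\mathfrak{Lie}}$-module structure on $H_t(\mathsf{CE}_{\mathfrak{Lie}}\otimes_{\mathsf{Cat}_{\mathfrak{Lie}}}\mathbb{Q}\mathfrak{S}_n)$ is induced by the underlying left $\mathbb{Q}\Sigma$-module structure: each morphism $f$ of $\mathsf{Cat}_{\mathfrak{Lie}}$ acts in the same way as the image of $f$ under $\mathsf{Cat}_{\mathfrak{Lie}}\to\mathbb{Q}\Sigma\to\mathsf{Cat}_{\mathfrak{Lie}}$.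 2. As left $\mathbb{Q}\Sigma$-, right $\mathbb{Q}\mathfrak{S}_n$-bimodules, $$H_t(\mathsf{CE}_{\mathfrak{Lie}}\otimes_{\mathsf{Cat}_{\mathfrak{Lie}}}\mathbb{Q}\mathfrak{S}_n)(m)\cong\begin{cases}\mathbb{Q}\mathfrak{S}_m\odot\mathrm{sgn}_t & \text{if } m+t=n,\\ 0&\text{otherwise.}\end{cases}$$ Here $\odot$ is formed with respect to the right actions of $\mathfrak{S}_m$ and $\mathfrak{S}_t$, giving a right $\mathbb{Q}\mathfrak{S}_n$-module, and $\mathfrak{S}_m$ acts on the left through the left regular action on $\mathbb{Q}\mathfrak{S}_m$. -/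

import Mathlib

open CategoryTheory Opposite TensorProduct

namespace LieProp

noncomputable section

/-- The number of leaves of a planar binary tree that carry the label `a`. -/
def leafCount {α : Type} [DecidableEq α] (a : α) : FreeMagma α → ℕ
  | .of b => if b = a then 1 else 0
  | .mul s t => leafCount a s + leafCount a t

@[simp] theorem leafCount_of {α : Type} [DecidableEq α] (a b : α) :
    leafCount a (FreeMagma.of b) = if b = a then 1 else 0 := rfl

@[simp] theorem leafCount_mul {α : Type} [DecidableEq α] (a : α) (s t : FreeMagma α) :
    leafCount a (s * t) = leafCount a s + leafCount a t := rfl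

theorem leafCount_lift {α β : Type} [DecidableEq α] [Fintype β] [DecidableEq β] (a : α)
    (f : β → FreeMagma α) (T : FreeMagma β) :
    leafCount a (FreeMagma.lift f T) = ∑ b, leafCount b T * leafCount a (f b) := by
  induction T with
  | ih1 x => simp
  | ih2 x y hx hy => simp [hx, hy, add_mul, Finset.sum_add_distrib]

theorem lift_lift {α β γ : Type} (f : β → FreeMagma α) (g : γ → FreeMagma β) (T : FreeMagma γ) :
    FreeMagma.lift f (FreeMagma.lift g T) = FreeMagma.lift (fun c => FreeMagma.lift f (g c)) T := by
  induction T with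
  | ih1 x => simp
  | ih2 x y hx hy => simp [hx, hy]

theorem lift_of_eq {α : Type} (T : FreeMagma α) : FreeMagma.lift FreeMagma.of T = T := by
  induction T with
  | ih1 x => simp
  | ih2 x y hx hy => simp [hx, hy]

theorem map_eq_lift {α β : Type} (f : α → β) (T : FreeMagma α) :
    FreeMagma.map f T = FreeMagma.lift (fun a => FreeMagma.of (f a)) T := rfl

/-- A multilinear Lie word: a sequence of `n` planar binary trees, one for each output (bracketings,
a product of two trees standing for their Lie bracket), in which each of the `m` input labels occurs
on exactly one leaf.  Sending an input to the tree on which it occurs is a surjection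
from the inputs onto the outputs. -/
@[ext]
structure Forest (m n : ℕ) where
  tree : Fin n → FreeMagma (Fin m)
  multilinear : ∀ a, ∑ i, leafCount a (tree i) = 1

theorem sum_leafCount_lift {α β : Type} [DecidableEq α] [Fintype β] [DecidableEq β] {n : ℕ} (a : α)
    (f : β → FreeMagma α) (T : Fin n → FreeMagma β) :
    ∑ i, leafCount a (FreeMagma.lift f (T i)) =
      ∑ b, (∑ i, leafCount b (T i)) * leafCount a (f b) := by
  simp only [leafCount_lift, Finset.sum_mul]
  exact Finset.sum_comm

/-- Bijections as forests without brackets: the output `i` is the input `σ⁻¹ i`. -/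
def Forest.perm {m n : ℕ} (σ : Fin m ≃ Fin n) : Forest m n where
  tree i := FreeMagma.of (σ.symm i)
  multilinear a := by simp [Equiv.symm_apply_eq]

/-- Composition of forests is grafting (substitution of words for letters). -/
def Forest.comp {a b c : ℕ} (F : Forest a b) (G : Forest b c) : Forest a c where
  tree i := FreeMagma.lift F.tree (G.tree i)
  multilinear x := by
    rw [sum_leafCount_lift]
    simp [G.multilinear, F.multilinear]

/-- Juxtaposition of a forest with `t` trivial trees. -/
def Forest.box (t : ℕ) {m n : ℕ} (F : Forest m n) : Forest (m + t) (n + t) where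
  tree := Fin.addCases (fun i => FreeMagma.map (Fin.castAdd t) (F.tree i))
    (fun j => FreeMagma.of (Fin.natAdd m j))
  multilinear a := by
    rw [Fin.sum_univ_add]
    simp only [Fin.addCases_left, Fin.addCases_right, map_eq_lift]
    rw [sum_leafCount_lift]
    simp only [F.multilinear, one_mul, leafCount_of]
    induction a using Fin.addCases with
    | left a =>
      simp only [Fin.castAdd_inj, Finset.sum_ite_eq', Finset.mem_univ, if_true]
      simp [Fin.ext_iff]; intro i; omega
    | right a =>
      have h1 : ∀ x : Fin m, (Fin.castAdd t x = Fin.natAdd m a) = False := fun x => by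
        simp [Fin.ext_iff]; omega
      simp [h1, Fin.natAdd_inj]

/-- The forest with `N + 1` inputs and `N` outputs that omits the input `j` from the list of inputs
and brackets it, on the right, onto the `i`-th remaining input. -/
def Forest.bracket {N : ℕ} (i : Fin N) (j : Fin (N + 1)) : Forest (N + 1) N where
  tree k := if k = i then FreeMagma.of (j.succAbove k) * FreeMagma.of j
    else FreeMagma.of (j.succAbove k)
  multilinear a := by
    have h : ∀ k : Fin N, leafCount a (if k = i then FreeMagma.of (j.succAbove k) * FreeMagma.of j
        else FreeMagma.of (j.succAbove k)) =
        (if j.succAbove k = a then 1 else 0) + (if k = i then (if j = a then 1 else 0) else 0) := by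
      intro k; by_cases hk : k = i <;> simp [hk]
    simp only [h, Finset.sum_add_distrib, Finset.sum_ite_eq', Finset.mem_univ, if_true]
    have := Fin.sum_univ_succAbove (fun k => if k = a then 1 else 0) j
    rw [add_comm, ← this]; simp

/-- Insert the tree `T` at the leaves marked `none` of a sequence of trees. -/
def plug {m n : ℕ} (G : Fin n → FreeMagma (Option (Fin m))) (T : FreeMagma (Fin m)) :
    Fin n → FreeMagma (Fin m) :=
  fun i => FreeMagma.lift (fun o => o.elim T FreeMagma.of) (G i)

/-- The antisymmetry and Jacobi relations, at an arbitrary subtree of a forest. -/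
inductive IsRelation {m n : ℕ} : (Forest m n →₀ ℚ) → Prop
  | antisymm (G : Fin n → FreeMagma (Option (Fin m))) (hG : ∑ i, leafCount none (G i) = 1)
      (A B : FreeMagma (Fin m)) (F₁ F₂ : Forest m n)
      (h₁ : F₁.tree = plug G (A * B)) (h₂ : F₂.tree = plug G (B * A)) :
      IsRelation (Finsupp.single F₁ 1 + Finsupp.single F₂ 1)
  | jacobi (G : Fin n → FreeMagma (Option (Fin m))) (hG : ∑ i, leafCount none (G i) = 1)
      (A B C : FreeMagma (Fin m)) (F₁ F₂ F₃ : Forest m n)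
      (h₁ : F₁.tree = plug G ((A * B) * C)) (h₂ : F₂.tree = plug G ((B * C) * A))
      (h₃ : F₃.tree = plug G ((C * A) * B)) :
      IsRelation (Finsupp.single F₁ 1 + Finsupp.single F₂ 1 + Finsupp.single F₃ 1)

/-- The span of the antisymmetry and Jacobi relations. -/
def relations (m n : ℕ) : Submodule ℚ (Forest m n →₀ ℚ) := Submodule.span ℚ {x | IsRelation x}

theorem relations_map {m n m' n' : ℕ} (Φ : Forest m n → Forest m' n')
    (c : (Fin n → FreeMagma (Option (Fin m))) → (Fin n' → FreeMagma (Option (Fin m'))))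
    (θ : FreeMagma (Fin m) →ₙ* FreeMagma (Fin m'))
    (hc : ∀ G, ∑ i, leafCount none (G i) = 1 → ∑ i, leafCount none (c G i) = 1)
    (h : ∀ F G T, F.tree = plug G T → (Φ F).tree = plug (c G) (θ T)) :
    relations m n ≤ (relations m' n').comap (Finsupp.lmapDomain ℚ ℚ Φ) := by
  refine Submodule.span_le.2 ?_
  rintro x (⟨G, hG, A, B, F₁, F₂, h₁, h₂⟩ | ⟨G, hG, A, B, C, F₁, F₂, F₃, h₁, h₂, h₃⟩)
  · refine Submodule.subset_span ?_
    simp only [map_add, Finsupp.lmapDomain_apply, Finsupp.mapDomain_single]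
    exact .antisymm (c G) (hc G hG) (θ A) (θ B) _ _ (by rw [← map_mul]; exact h _ _ _ h₁)
      (by rw [← map_mul]; exact h _ _ _ h₂)
  · refine Submodule.subset_span ?_
    simp only [map_add, Finsupp.lmapDomain_apply, Finsupp.mapDomain_single]
    exact .jacobi (c G) (hc G hG) (θ A) (θ B) (θ C) _ _ _
      (by rw [← map_mul, ← map_mul]; exact h _ _ _ h₁)
      (by rw [← map_mul, ← map_mul]; exact h _ _ _ h₂)
      (by rw [← map_mul, ← map_mul]; exact h _ _ _ h₃)

theorem relations_precomp {a b c : ℕ} (H : Forest a b) :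
    relations b c ≤ (relations a c).comap (Finsupp.lmapDomain ℚ ℚ H.comp) := by
  refine relations_map _
    (fun G i => FreeMagma.lift
      (fun o => o.elim (FreeMagma.of none) (fun x => FreeMagma.map some (H.tree x))) (G i))
    (FreeMagma.lift H.tree) ?_ ?_
  · intro G hG
    rw [sum_leafCount_lift, Fintype.sum_option]
    simp [hG, map_eq_lift, leafCount_lift]
  · intro F G T h
    funext i
    simp only [Forest.comp, h, plug, lift_lift]
    congr 2
    funext o
    cases o <;> simp [map_eq_lift, lift_lift, lift_of_eq]

theorem relations_postcomp {a b c : ℕ} (K : Forest b c) :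
    relations a b ≤ (relations a c).comap (Finsupp.lmapDomain ℚ ℚ fun F => F.comp K) := by
  refine relations_map _ (fun G i => FreeMagma.lift G (K.tree i)) (MulHom.id _) ?_ ?_
  · intro G hG
    rw [sum_leafCount_lift]
    simp [K.multilinear, hG]
  · intro F G T h
    funext i
    simp only [Forest.comp, h, plug, lift_lift]
    rfl

theorem relations_box (t : ℕ) {m n : ℕ} :
    relations m n ≤ (relations (m + t) (n + t)).comap
      (Finsupp.lmapDomain ℚ ℚ (Forest.box t)) := by
  refine relations_map _
    (fun G => Fin.addCases (fun i => FreeMagma.map (Option.map (Fin.castAdd t)) (G i))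
      (fun j => FreeMagma.of (some (Fin.natAdd m j))))
    (FreeMagma.map (Fin.castAdd t)) ?_ ?_
  · intro G hG
    rw [Fin.sum_univ_add]
    simp only [Fin.addCases_left, Fin.addCases_right]
    simp only [map_eq_lift]
    rw [sum_leafCount_lift, Fintype.sum_option]
    simp [hG]
  · intro F G T h
    funext i
    induction i using Fin.addCases with
    | left i =>
      simp only [Forest.box, plug, Fin.addCases_left, h, map_eq_lift, lift_lift]
      congr 2
      funext o
      cases o <;> simp [map_eq_lift]
    | right i => simp [Forest.box, plug]


theorem Forest.comp_assoc {a b c d : ℕ} (F : Forest a b) (G : Forest b c) (H : Forest c d) :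
    (F.comp G).comp H = F.comp (G.comp H) :=
  Forest.ext (funext fun i => by simp only [Forest.comp, lift_lift])

theorem Forest.box_comp (t : ℕ) {a b c : ℕ} (F : Forest a b) (G : Forest b c) :
    (F.comp G).box t = (F.box t).comp (G.box t) := by
  refine Forest.ext (funext fun i => ?_)
  induction i using Fin.addCases with
  | left i => simp [Forest.box, Forest.comp, map_eq_lift, lift_lift]
  | right i => simp [Forest.box, Forest.comp]

theorem Forest.perm_comp {a b c : ℕ} (σ : Fin a ≃ Fin b) (τ : Fin b ≃ Fin c) :
    (Forest.perm σ).comp (Forest.perm τ) = Forest.perm (σ.trans τ) := rfl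

theorem Forest.perm_comp_tree {a b c : ℕ} (σ : Fin a ≃ Fin b) (F : Forest b c) :
    ((Forest.perm σ).comp F).tree = fun i => FreeMagma.map σ.symm (F.tree i) := rfl

theorem Forest.comp_perm_tree {a b c : ℕ} (F : Forest a b) (σ : Fin b ≃ Fin c) :
    (F.comp (Forest.perm σ)).tree = fun i => F.tree (σ.symm i) := rfl

theorem Forest.perm_refl_comp {a b : ℕ} (F : Forest a b) :
    (Forest.perm (Equiv.refl _)).comp F = F :=
  Forest.ext (funext fun _ => lift_of_eq _)

theorem Forest.comp_perm_refl {a b : ℕ} (F : Forest a b) :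
    F.comp (Forest.perm (Equiv.refl _)) = F := rfl

theorem Forest.box_perm_refl (t a : ℕ) :
    (Forest.perm (Equiv.refl (Fin a))).box t = Forest.perm (Equiv.refl _) := by
  refine Forest.ext (funext fun i => ?_)
  induction i using Fin.addCases with
  | left i => simp [Forest.box, Forest.perm]
  | right i => simp [Forest.box, Forest.perm]

/-- The morphisms from `m` to `n` of the PROP of the Lie operad: forests modulo antisymmetry and
the Jacobi identity.  Splitting forests according to the surjection `f` sending an input to the tree
on which it occurs, this is `⨁_f ⨂_i Lie(f⁻¹(i))`, where `Lie(S)` denotes multilinear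
trees on `S` modulo antisymmetry and Jacobi. -/
abbrev HomSpace (m n : ℕ) : Type := (Forest m n →₀ ℚ) ⧸ relations m n

/-- The class of a forest. -/
def word {m n : ℕ} (F : Forest m n) : HomSpace m n := Submodule.Quotient.mk (Finsupp.single F 1)

theorem homSpace_ext {m n : ℕ} {N : Type*} [AddCommGroup N] [Module ℚ N]
    {f g : HomSpace m n →ₗ[ℚ] N} (h : ∀ F, f (word F) = g (word F)) : f = g := by
  refine Submodule.linearMap_qext _ (Finsupp.lhom_ext' fun F => LinearMap.ext_ring ?_)
  exact h F

/-- A map of forests compatible with the relations induces a linear map. -/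
def mapHom {m n m' n' : ℕ} (Φ : Forest m n → Forest m' n')
    (h : relations m n ≤ (relations m' n').comap (Finsupp.lmapDomain ℚ ℚ Φ)) :
    HomSpace m n →ₗ[ℚ] HomSpace m' n' :=
  Submodule.mapQ _ _ (Finsupp.lmapDomain ℚ ℚ Φ) h

theorem mapHom_word {m n m' n' : ℕ} (Φ : Forest m n → Forest m' n')
    (h : relations m n ≤ (relations m' n').comap (Finsupp.lmapDomain ℚ ℚ Φ)) (F : Forest m n) :
    mapHom Φ h (word F) = word (Φ F) := by
  simp [mapHom, word]

/-- The bilinear extension of grafting, `compHom K φ` being `φ` followed by `K`. -/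
def compHom (a b c : ℕ) : HomSpace b c →ₗ[ℚ] HomSpace a b →ₗ[ℚ] HomSpace a c :=
  (relations b c).liftQ
    (Finsupp.linearCombination ℚ fun K => mapHom (fun F => F.comp K) (relations_postcomp K)) (by
      intro x hx
      rw [LinearMap.mem_ker]
      refine homSpace_ext fun H => ?_
      have h1 : (Finsupp.linearCombination ℚ fun K : Forest b c =>
          mapHom (fun F : Forest a b => F.comp K) (relations_postcomp K)).flip (word H) =
          (relations a c).mkQ ∘ₗ Finsupp.lmapDomain ℚ ℚ H.comp := by
        refine Finsupp.lhom_ext' fun K => LinearMap.ext_ring ?_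
        simp [mapHom_word]
        rfl
      have h2 := LinearMap.congr_fun h1 x
      rw [LinearMap.flip_apply] at h2
      rw [h2]
      simpa using relations_precomp H hx)

@[simp] theorem compHom_word {a b c : ℕ} (F : Forest a b) (G : Forest b c) :
    compHom a b c (word G) (word F) = word (F.comp G) := by
  have : compHom a b c (word G) = mapHom (fun F => F.comp G) (relations_postcomp G) := by
    simp [compHom, word]
  rw [this, mapHom_word]

/-- The `ℚ`-linear category with objects the natural numbers which is the PROP of the Lie operad. -/
@[ext]
structure CatLie where
  n : ℕ

theorem homSpace_induction {m n : ℕ} {P : HomSpace m n → Prop} (f : HomSpace m n)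
    (h0 : P 0) (hadd : ∀ x y, P x → P y → P (x + y)) (hw : ∀ (r : ℚ) F, P (r • word F)) : P f := by
  obtain ⟨f, rfl⟩ := Submodule.Quotient.mk_surjective _ f
  induction f using Finsupp.induction_linear with
  | zero => exact h0
  | add x y hx hy => exact hadd _ _ hx hy
  | single F r =>
    have : Finsupp.single F r = r • Finsupp.single F (1 : ℚ) := by simp
    rw [this]
    exact hw r F

theorem compHom_assoc {a b c d : ℕ} (f : HomSpace a b) (g : HomSpace b c) (h : HomSpace c d) :
    compHom a b d (compHom b c d h g) f = compHom a c d h (compHom a b c g f) := by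
  induction f using homSpace_induction with
  | h0 => simp
  | hadd x y hx hy => simp [hx, hy]
  | hw r F =>
    induction g using homSpace_induction with
    | h0 => simp
    | hadd x y hx hy => simp only [map_add, LinearMap.add_apply, hx, hy]
    | hw s G =>
      induction h using homSpace_induction with
      | h0 => simp
      | hadd x y hx hy => simp only [map_add, LinearMap.add_apply, hx, hy]
      | hw t H => simp [Forest.comp_assoc]

instance : Category CatLie where
  Hom a b := HomSpace a.n b.n
  id a := word (Forest.perm (Equiv.refl _))
  comp f g := compHom _ _ _ g f
  id_comp {a b} f := by
    suffices H : (compHom a.n a.n b.n).flip (word (Forest.perm (Equiv.refl _))) = LinearMap.id from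
      LinearMap.congr_fun H f
    refine homSpace_ext fun F => ?_
    simp [Forest.perm_refl_comp]
  comp_id {a b} f := by
    suffices H : compHom a.n b.n b.n (word (Forest.perm (Equiv.refl _))) = LinearMap.id from
      LinearMap.congr_fun H f
    refine homSpace_ext fun F => ?_
    simp [Forest.comp_perm_refl]
  assoc f g h := (compHom_assoc f g h).symm

instance : Preadditive CatLie where
  homGroup a b := inferInstanceAs (AddCommGroup (HomSpace a.n b.n))
  add_comp _ _ _ f f' g := (compHom _ _ _ g).map_add f f'
  comp_add _ _ _ f g g' := LinearMap.congr_fun ((compHom _ _ _).map_add g g') f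

instance : Linear ℚ CatLie where
  homModule a b := inferInstanceAs (Module ℚ (HomSpace a.n b.n))
  smul_comp _ _ _ r f g := (compHom _ _ _ g).map_smul r f
  comp_smul _ _ _ f r g := LinearMap.congr_fun ((compHom _ _ _).map_smul r g) f

/-- The functor `- ⊞ t` on morphisms. -/
def boxHom (t m n : ℕ) : HomSpace m n →ₗ[ℚ] HomSpace (m + t) (n + t) :=
  mapHom (Forest.box t) (relations_box t)

@[simp] theorem boxHom_word (t : ℕ) {m n : ℕ} (F : Forest m n) :
    boxHom t m n (word F) = word (F.box t) := mapHom_word _ _ _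

theorem boxHom_comp (t : ℕ) {a b c : ℕ} (f : HomSpace a b) (g : HomSpace b c) :
    boxHom t a c (compHom a b c g f) =
      compHom _ _ _ (boxHom t b c g) (boxHom t a b f) := by
  induction f using homSpace_induction with
  | h0 => simp
  | hadd x y hx hy => simp [hx, hy]
  | hw r F =>
    induction g using homSpace_induction with
    | h0 => simp
    | hadd x y hx hy => simp only [map_add, LinearMap.add_apply, hx, hy]
    | hw s G => simp [Forest.box_comp]

theorem boxHom_boxHom (t m n : ℕ) (f : HomSpace m n) :
    boxHom 1 _ _ (boxHom t m n f) = boxHom (t + 1) m n f := by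
  induction f using homSpace_induction with
  | h0 => simp
  | hadd x y hx hy => simp only [map_add, hx, hy]
  | hw r F =>
    simp only [map_smul, boxHom_word]
    congr 2
    refine Forest.ext (funext fun i => ?_)
    induction i using Fin.lastCases with
    | last =>
      have h1 : (Fin.last (n + t)) = Fin.natAdd (n + t) (0 : Fin 1) := rfl
      have h2 : (Fin.last (n + t)) = Fin.natAdd n (Fin.last t) := rfl
      have h3 : ((F.box t).box 1).tree (Fin.natAdd (n + t) (0 : Fin 1)) =
        FreeMagma.of (Fin.last (m + t)) := by simp [Forest.box]; rfl
      have h4 : (F.box (t + 1)).tree (Fin.natAdd n (Fin.last t)) =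
        FreeMagma.of (Fin.last (m + t)) := by
        unfold Forest.box
        dsimp only
        rw [Fin.addCases_right]
        rfl
      exact (congrArg _ h1).trans (h3.trans (h4.symm.trans (congrArg _ h2.symm)))
    | cast i =>
      have h3 : ((F.box t).box 1).tree (Fin.castAdd 1 i) =
        FreeMagma.map (Fin.castAdd 1) ((F.box t).tree i) := by simp [Forest.box]
      refine Eq.trans h3 ?_
      induction i using Fin.addCases with
      | left i =>
        have h4 : (F.box (t + 1)).tree (Fin.castAdd (t + 1) i) =
          FreeMagma.map (Fin.castAdd (t + 1)) (F.tree i) := by simp [Forest.box]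
        refine Eq.trans ?_ h4.symm
        simp [Forest.box, map_eq_lift, lift_lift]
        rfl
      | right i =>
        have h4 : (F.box (t + 1)).tree (Fin.natAdd n i.castSucc) =
          FreeMagma.of (Fin.natAdd m i.castSucc) := by simp [Forest.box]
        refine Eq.trans ?_ h4.symm
        simp [Forest.box]
        rfl

/-- The endofunctor `- ⊞ t` of the PROP of the Lie operad. -/
def box (t : ℕ) : CatLie ⥤ CatLie where
  obj a := ⟨a.n + t⟩
  map {a b} f := boxHom t a.n b.n f
  map_id a := (boxHom_word _ _).trans (by rw [Forest.box_perm_refl]; rfl)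
  map_comp f g := boxHom_comp t f g

/-- The skeleton of the category of finite sets and bijections, with objects the sets
`Fin n`. -/
structure PermCat where
  n : ℕ

instance : Category PermCat where
  Hom a b := Fin a.n ≃ Fin b.n
  id a := Equiv.refl _
  comp f g := f.trans g

/-- Bijections inside the PROP. -/
def permFunctor : PermCat ⥤ CatLie where
  obj a := ⟨a.n⟩
  map σ := word (Forest.perm σ)
  map_id _ := rfl
  map_comp f g := (compHom_word (Forest.perm f) (Forest.perm g)).symm

/-- The inclusion `ℚΣ ⥤ CatLie` induced by the unit of the Lie operad. -/
def unit : Free ℚ PermCat ⥤ CatLie := Free.lift ℚ permFunctor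

open Classical in
/-- The augmentation on forests: a forest without brackets is sent to the corresponding
bijection, a forest with a bracket is sent to zero. -/
def Forest.aug {m n : ℕ} (F : Forest m n) : (Fin m ≃ Fin n) →₀ ℚ :=
  if h : ∃ σ, F = Forest.perm σ then Finsupp.single h.choose 1 else 0

theorem Forest.perm_injective {m n : ℕ} : Function.Injective (Forest.perm (m := m) (n := n)) := by
  intro σ τ h
  have h1 := congrArg Forest.tree h
  have : σ.symm = τ.symm := Equiv.ext fun i => by
    have := congrFun h1 i
    injection this
  simpa using congrArg Equiv.symm this

theorem Forest.aug_perm {m n : ℕ} (σ : Fin m ≃ Fin n) :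
    (Forest.perm σ).aug = Finsupp.single σ 1 := by
  have h : ∃ τ, Forest.perm σ = Forest.perm τ := ⟨σ, rfl⟩
  rw [Forest.aug, dif_pos h, ← Forest.perm_injective h.choose_spec]

theorem Forest.aug_eq_zero {m n : ℕ} (F : Forest m n) (i : Fin n) (A B : FreeMagma (Fin m))
    (h : F.tree i = A * B) : F.aug = 0 := by
  rw [Forest.aug, dif_neg]
  rintro ⟨σ, rfl⟩
  cases h

theorem Forest.exists_perm {m n : ℕ} (F : Forest m n) (h : ∀ i, ∃ j, F.tree i = FreeMagma.of j) :
    ∃ σ, F = Forest.perm σ := by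
  choose j hj using h
  have hF := F.multilinear
  simp only [hj, leafCount_of] at hF
  have hb : Function.Bijective j := by
    constructor
    · intro x y hxy
      by_contra hne
      have h1 := hF (j x)
      have h2 : ∑ i ∈ {x, y}, (if j i = j x then 1 else 0) ≤ ∑ i, if j i = j x then 1 else 0 :=
        Finset.sum_le_univ_sum_of_nonneg (by simp)
      rw [h1, Finset.sum_pair hne] at h2
      simp [hxy] at h2
    · intro a
      by_contra hne
      push Not at hne
      have h1 := hF a
      simp [hne] at h1
  refine ⟨(Equiv.ofBijective j hb).symm, Forest.ext (funext fun i => ?_)⟩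
  simp [Forest.perm, hj]

theorem Forest.aug_comp_of_bracket {a b c : ℕ} (F : Forest a b) (G : Forest b c) 
    (i : Fin b) (A B : FreeMagma (Fin a)) (h : F.tree i = A * B) : (F.comp G).aug = 0 := by
  by_cases hG : ∀ i, ∃ j, G.tree i = FreeMagma.of j
  · obtain ⟨σ, rfl⟩ := G.exists_perm hG
    exact Forest.aug_eq_zero _ (σ i) A B (by simp [Forest.comp_perm_tree, h])
  · push Not at hG
    obtain ⟨k, hk⟩ := hG
    cases hT : G.tree k with
    | of x => exact absurd hT (hk x)
    | mul S T => exact Forest.aug_eq_zero _ k _ _ (by simp only [Forest.comp, hT]; rfl)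

theorem plug_bracket {m n : ℕ} (G : Fin n → FreeMagma (Option (Fin m)))
    (hG : ∑ i, leafCount none (G i) = 1) (A B : FreeMagma (Fin m)) :
    ∃ i S T, plug G (A * B) i = S * T := by
  obtain ⟨i, hi⟩ : ∃ i, leafCount none (G i) ≠ 0 := by
    by_contra h
    push Not at h
    simp [h] at hG
  refine ⟨i, ?_⟩
  unfold plug
  cases hT : G i with
  | of x =>
    cases x with
    | none => exact ⟨A, B, rfl⟩
    | some x => simp [hT] at hi
  | mul S T => exact ⟨_, _, rfl⟩

theorem aug_relations (m n : ℕ) :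
    relations m n ≤ LinearMap.ker (Finsupp.linearCombination ℚ (Forest.aug (m := m) (n := n))) := by
  have key : ∀ (F : Forest m n) G A B, ∑ i, leafCount none (G i) = 1 → F.tree = plug G (A * B) →
      F.aug = 0 := by
    intro F G A B hG hF
    obtain ⟨i, S, T, h⟩ := plug_bracket G hG A B
    exact F.aug_eq_zero i S T (by rw [hF, h])
  refine Submodule.span_le.2 ?_
  rintro x (⟨G, hG, A, B, F₁, F₂, h₁, h₂⟩ | ⟨G, hG, A, B, C, F₁, F₂, F₃, h₁, h₂, h₃⟩)
  · simp [key _ _ _ _ hG h₁, key _ _ _ _ hG h₂]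
  · simp [key _ _ _ _ hG h₁, key _ _ _ _ hG h₂, key _ _ _ _ hG h₃]

/-- The augmentation on morphism spaces. -/
def augHom (m n : ℕ) : HomSpace m n →ₗ[ℚ] ((Fin m ≃ Fin n) →₀ ℚ) :=
  (relations m n).liftQ (Finsupp.linearCombination ℚ Forest.aug) (aug_relations m n)

@[simp] theorem augHom_word {m n : ℕ} (F : Forest m n) : augHom m n (word F) = F.aug := by
  simp [augHom, word]

/-- Composition in `ℚΣ` as a bilinear map. -/
def compPerm (a b c : ℕ) : ((Fin a ≃ Fin b) →₀ ℚ) →ₗ[ℚ] ((Fin b ≃ Fin c) →₀ ℚ) →ₗ[ℚ]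
    ((Fin a ≃ Fin c) →₀ ℚ) :=
  Linear.comp (S := ℚ) (Free.of ℚ (⟨a⟩ : PermCat)) (Free.of ℚ (⟨b⟩ : PermCat))
    (Free.of ℚ (⟨c⟩ : PermCat))

theorem compPerm_single {a b c : ℕ} (σ : Fin a ≃ Fin b) (τ : Fin b ≃ Fin c) :
    compPerm a b c (Finsupp.single σ 1) (Finsupp.single τ 1) =
      Finsupp.single (σ.trans τ) 1 := by
  have := Free.single_comp_single ℚ (C := PermCat) (X := ⟨a⟩) (Y := ⟨b⟩) (Z := ⟨c⟩) σ τ 1 1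
  rw [mul_one] at this
  exact this

theorem Forest.aug_comp {a b c : ℕ} (F : Forest a b) (G : Forest b c) :
    (F.comp G).aug = compPerm a b c F.aug G.aug := by
  by_cases hF : ∀ i, ∃ j, F.tree i = FreeMagma.of j
  · by_cases hG : ∀ i, ∃ j, G.tree i = FreeMagma.of j
    · obtain ⟨σ, rfl⟩ := F.exists_perm hF
      obtain ⟨τ, rfl⟩ := G.exists_perm hG
      rw [Forest.perm_comp, Forest.aug_perm, Forest.aug_perm, Forest.aug_perm, compPerm_single]
    · push Not at hG
      obtain ⟨k, hk⟩ := hG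
      cases hT : G.tree k with
      | of x => exact absurd hT (hk x)
      | mul S T =>
        rw [Forest.aug_eq_zero G k S T hT, map_zero]
        exact Forest.aug_eq_zero _ k _ _ (by simp only [Forest.comp, hT]; rfl)
  · push Not at hF
    obtain ⟨k, hk⟩ := hF
    cases hT : F.tree k with
    | of x => exact absurd hT (hk x)
    | mul S T =>
      rw [Forest.aug_eq_zero F k S T hT, Forest.aug_comp_of_bracket F G k S T hT, map_zero,
        LinearMap.zero_apply]

theorem augHom_comp {a b c : ℕ} (f : HomSpace a b) (g : HomSpace b c) :
    augHom a c (compHom a b c g f) = compPerm a b c (augHom a b f) (augHom b c g) := by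
  induction f using homSpace_induction with
  | h0 => simp
  | hadd x y hx hy => simp only [map_add, LinearMap.add_apply, hx, hy]
  | hw r F =>
    induction g using homSpace_induction with
    | h0 => simp
    | hadd x y hx hy => simp only [map_add, LinearMap.add_apply, hx, hy]
    | hw s G => simp [Forest.aug_comp, smul_comm r s]

/-- The augmentation `CatLie ⥤ ℚΣ` induced by the augmentation of the Lie operad. -/
def aug : CatLie ⥤ Free ℚ PermCat where
  obj a := Free.of ℚ (⟨a.n⟩ : PermCat)
  map {a b} f := augHom a.n b.n f
  map_id _ := (augHom_word _).trans (Forest.aug_perm _)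
  map_comp f g := augHom_comp f g

theorem word_antisymm {m n : ℕ} (G : Fin n → FreeMagma (Option (Fin m)))
    (hG : ∑ i, leafCount none (G i) = 1) (A B : FreeMagma (Fin m)) (F₁ F₂ : Forest m n)
    (h₁ : F₁.tree = plug G (A * B)) (h₂ : F₂.tree = plug G (B * A)) :
    word F₁ + word F₂ = 0 := by
  have : Finsupp.single F₁ 1 + Finsupp.single F₂ 1 ∈ relations m n :=
    Submodule.subset_span (.antisymm G hG A B F₁ F₂ h₁ h₂)
  simpa [word] using (Submodule.Quotient.mk_eq_zero _).2 this

theorem word_jacobi {m n : ℕ} (G : Fin n → FreeMagma (Option (Fin m)))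
    (hG : ∑ i, leafCount none (G i) = 1) (A B C : FreeMagma (Fin m)) (F₁ F₂ F₃ : Forest m n)
    (h₁ : F₁.tree = plug G ((A * B) * C)) (h₂ : F₂.tree = plug G ((B * C) * A))
    (h₃ : F₃.tree = plug G ((C * A) * B)) :
    word F₁ + word F₂ + word F₃ = 0 := by
  have : Finsupp.single F₁ 1 + Finsupp.single F₂ 1 + Finsupp.single F₃ 1 ∈ relations m n :=
    Submodule.subset_span (.jacobi G hG A B C F₁ F₂ F₃ h₁ h₂ h₃)
  simpa [word] using (Submodule.Quotient.mk_eq_zero _).2 this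

/-- The action `μ(N)` of the last input on the others, `∑ i, x_0 ⊗ ⋯ ⊗ [x_i, x_N] ⊗ ⋯`. -/
def mu (N : ℕ) : HomSpace (N + 1) N := ∑ i, word (Forest.bracket i (Fin.last N))

theorem bracket_last_tree {N : ℕ} (i k : Fin N) :
    (Forest.bracket i (Fin.last N)).tree k =
      if k = i then FreeMagma.of k.castSucc * FreeMagma.of (Fin.last N)
      else FreeMagma.of k.castSucc := by
  simp [Forest.bracket, Fin.succAbove_last]

theorem box_one_castSucc {m n : ℕ} (F : Forest m n) (i : Fin n) :
    (F.box 1).tree i.castSucc = FreeMagma.map Fin.castSucc (F.tree i) := by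
  have : (F.box 1).tree (Fin.castAdd 1 i) = FreeMagma.map (Fin.castAdd 1) (F.tree i) := by
    simp [Forest.box]
  exact this

theorem box_one_last {m n : ℕ} (F : Forest m n) :
    (F.box 1).tree (Fin.last n) = FreeMagma.of (Fin.last m) := by
  have : (F.box 1).tree (Fin.natAdd n (0 : Fin 1)) = FreeMagma.of (Fin.natAdd m (0 : Fin 1)) := by
    simp [Forest.box]
  exact this

theorem bracket_box {N : ℕ} (i : Fin N) (j : Fin (N + 1)) :
    (Forest.bracket i j).box 1 = Forest.bracket i.castSucc j.castSucc := by
  refine Forest.ext (funext fun k => ?_)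
  induction k using Fin.lastCases with
  | last =>
    rw [box_one_last]
    have h1 : j.castSucc.succAbove (Fin.last N) = Fin.last (N + 1) := by
      rw [Fin.succAbove_of_le_castSucc _ _ (Fin.castSucc_le_castSucc_iff.2 (Fin.le_last j)),
        Fin.succ_last]
    simp [Forest.bracket, h1, (Fin.castSucc_lt_last i).ne']
  | cast k =>
    rw [box_one_castSucc]
    by_cases h : k = i <;> simp [Forest.bracket, h, Fin.castSucc_succAbove_castSucc]

/-- Number of brackets of a tree. -/
def brackets {α : Type} : FreeMagma α → ℕ
  | .of _ => 0
  | .mul s t => brackets s + brackets t + 1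

theorem Forest.induction {P : ∀ {m n : ℕ}, HomSpace m n → Prop}
    (hperm : ∀ {m n : ℕ} (σ : Fin m ≃ Fin n), P (word (Forest.perm σ)))
    (hbr : ∀ {N : ℕ} (k : Fin N), P (word (Forest.bracket k (Fin.last N))))
    (hcomp : ∀ {a b c : ℕ} (f : HomSpace a b) (g : HomSpace b c), P f → P g →
      P (compHom a b c g f)) :
    ∀ {m n : ℕ} (F : Forest m n), P (word F) := by
  suffices H : ∀ (s : ℕ) {m n : ℕ} (F : Forest m n), ∑ i, brackets (F.tree i) = s → P (word F) from
    fun {m n} F => H _ F rfl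
  intro s
  induction s with
  | zero =>
    intro m n F hF
    obtain ⟨σ, rfl⟩ := F.exists_perm (fun i => by
      have : brackets (F.tree i) = 0 := by
        rw [Finset.sum_eq_zero_iff] at hF
        exact hF i (Finset.mem_univ i)
      cases hT : F.tree i with
      | of x => exact ⟨x, rfl⟩
      | mul S T => rw [hT] at this; simp [brackets] at this)
    exact hperm σ
  | succ s ih =>
    intro m n F hF
    obtain ⟨k, S, T, hk⟩ : ∃ k S T, F.tree k = S * T := by
      by_contra h
      push Not at h
      have : ∀ i, brackets (F.tree i) = 0 := by
        intro i
        cases hT : F.tree i with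
        | of x => rfl
        | mul S T => exact absurd hT (h i S T)
      simp [this] at hF
    let F' : Forest m (n + 1) :=
      { tree := Fin.snoc (α := fun _ => FreeMagma (Fin m)) (Function.update F.tree k S) T
        multilinear := fun a => by
          rw [Fin.sum_univ_castSucc]
          simp only [Fin.snoc_castSucc, Fin.snoc_last]
          rw [← F.multilinear a, ← Finset.add_sum_erase _ _ (Finset.mem_univ k),
            ← Finset.add_sum_erase _ _ (Finset.mem_univ k), hk]
          rw [Finset.sum_congr rfl (g := fun i => leafCount a (F.tree i))]
          · simp; ring
          · intro x hx
            rw [Function.update_of_ne (Finset.ne_of_mem_erase hx)] }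
    have hF' : F = F'.comp (Forest.bracket k (Fin.last n)) := by
      have hl : F'.tree (Fin.last n) = T := by simp only [F', Fin.snoc_last]
      have hc : ∀ i : Fin n, F'.tree i.castSucc = Function.update F.tree k S i :=
        fun i => by simp only [F', Fin.snoc_castSucc]
      refine Forest.ext (funext fun i => ?_)
      by_cases h : i = k
      · subst h
        simp [Forest.comp, bracket_last_tree, hl, hc, hk]
      · simp [Forest.comp, bracket_last_tree, hc, h]
    have hs : ∑ i, brackets (F'.tree i) = s := by
      rw [Fin.sum_univ_castSucc]
      simp only [F', Fin.snoc_castSucc, Fin.snoc_last]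
      rw [← Finset.add_sum_erase _ _ (Finset.mem_univ k), hk] at hF
      rw [← Finset.add_sum_erase _ _ (Finset.mem_univ k)]
      rw [Finset.sum_congr rfl (g := fun i => brackets (F.tree i))]
      · have : brackets (S * T) = brackets S + brackets T + 1 := rfl
        simp; omega
      · intro x hx
        rw [Function.update_of_ne (Finset.ne_of_mem_erase hx)]
    rw [hF', ← compHom_word]
    exact hcomp _ _ (ih F' hs) (hbr k)

theorem mu_perm {m n : ℕ} (σ : Fin m ≃ Fin n) :
    compHom (m + 1) m n (word (Forest.perm σ)) (mu m) =
      compHom (m + 1) (n + 1) n (mu n) (boxHom 1 m n (word (Forest.perm σ))) := by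
  simp only [mu, map_sum, LinearMap.sum_apply, boxHom_word, compHom_word]
  refine Fintype.sum_equiv σ _ _ fun i => ?_
  congr 1
  refine Forest.ext (funext fun k => ?_)
  by_cases h : k = σ i
  · subst h
    simp [Forest.comp, Forest.perm, bracket_last_tree, box_one_castSucc, box_one_last]
  · have h' : ¬ σ.symm k = i := fun e => h (by simp [← e])
    simp [Forest.comp, Forest.perm, bracket_last_tree, box_one_castSucc, h, h']

theorem leafCount_plug {m n : ℕ} (G : Fin n → FreeMagma (Option (Fin m))) (T T' : FreeMagma (Fin m))
    (h : ∀ a, leafCount a T' = leafCount a T) (a : Fin m) (i : Fin n) :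
    leafCount a (plug G T' i) = leafCount a (plug G T i) := by
  simp only [plug, leafCount_lift, Fintype.sum_option, Option.elim, h]

/-- Replace an inserted tree by another one with the same leaves. -/
def Forest.replug {m n : ℕ} (F : Forest m n) (G : Fin n → FreeMagma (Option (Fin m)))
    (T T' : FreeMagma (Fin m)) (hF : F.tree = plug G T)
    (h : ∀ a, leafCount a T' = leafCount a T) : Forest m n where
  tree := plug G T'
  multilinear a := by
    rw [← F.multilinear a, hF]
    exact Finset.sum_congr rfl fun i _ => leafCount_plug G T T' h a i

theorem mu_bracket {N : ℕ} (k : Fin N) :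
    compHom (N + 2) (N + 1) N (word (Forest.bracket k (Fin.last N))) (mu (N + 1)) =
      compHom (N + 2) (N + 1) N (mu N) (boxHom 1 _ _ (word (Forest.bracket k (Fin.last N)))) := by
  simp only [mu, map_sum, LinearMap.sum_apply, boxHom_word, compHom_word]
  rw [Fin.sum_univ_castSucc, ← Finset.add_sum_erase _ _ (Finset.mem_univ k),
    ← Finset.add_sum_erase (a := k) _ _ (Finset.mem_univ k)]
  rw [Finset.sum_congr rfl (g := fun i : Fin N =>
    word (((Forest.bracket k (Fin.last N)).box 1).comp (Forest.bracket i (Fin.last N))))]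
  · set R := ∑ x ∈ Finset.univ.erase k,
      word (((Forest.bracket k (Fin.last N)).box 1).comp (Forest.bracket x (Fin.last N)))
    have hk : (Fin.last N) ≠ k.castSucc := (Fin.castSucc_lt_last _).ne'
    -- the two relations that move a bracket past the other one, and the Jacobi identity
    let x : FreeMagma (Fin (N + 2)) := FreeMagma.of k.castSucc.castSucc
    let z : FreeMagma (Fin (N + 2)) := FreeMagma.of (Fin.last N).castSucc
    let y : FreeMagma (Fin (N + 2)) := FreeMagma.of (Fin.last (N + 1))
    let G₀ : Fin N → FreeMagma (Option (Fin (N + 2))) := fun r =>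
      if r = k then FreeMagma.of none else FreeMagma.of (some r.castSucc.castSucc)
    let G₁ : Fin N → FreeMagma (Option (Fin (N + 2))) := fun r =>
      if r = k then FreeMagma.of none * FreeMagma.of (some (Fin.last N).castSucc)
      else FreeMagma.of (some r.castSucc.castSucc)
    have hG₀ : ∑ i, leafCount none (G₀ i) = 1 := by
      have : ∀ i, leafCount none (G₀ i) = if i = k then 1 else 0 := fun i => by
        by_cases h : i = k <;> simp [G₀, h]
      simp [this]
    have hG₁ : ∑ i, leafCount none (G₁ i) = 1 := by
      have : ∀ i, leafCount none (G₁ i) = if i = k then 1 else 0 := fun i => by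
        by_cases h : i = k <;> simp [G₁, h]
      simp [this]
    let X₁ := (Forest.bracket k.castSucc (Fin.last (N + 1))).comp (Forest.bracket k (Fin.last N))
    let X₂ := (Forest.bracket (Fin.last N) (Fin.last (N + 1))).comp (Forest.bracket k (Fin.last N))
    let X₃ := ((Forest.bracket k (Fin.last N)).box 1).comp (Forest.bracket k (Fin.last N))
    have h₁ : X₁.tree = plug G₁ (x * y) := by
      funext r
      by_cases h : r = k
      · subst h
        simp [X₁, plug, G₁, Forest.comp, bracket_last_tree, hk, x, y]
      · simp [X₁, plug, G₁, Forest.comp, bracket_last_tree, h]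
    have h₂ : X₂.tree = plug G₀ (x * (z * y)) := by
      funext r
      by_cases h : r = k
      · subst h
        simp [X₂, plug, G₀, Forest.comp, bracket_last_tree, hk.symm, x, y, z]
      · simp [X₂, plug, G₀, Forest.comp, bracket_last_tree, h, (Fin.castSucc_lt_last _).ne]
    have h₃ : X₃.tree = plug G₀ ((x * z) * y) := by
      funext r
      by_cases h : r = k
      · subst h
        simp [X₃, plug, G₀, Forest.comp, bracket_last_tree, box_one_castSucc, box_one_last, x, y, z]
      · simp [X₃, plug, G₀, Forest.comp, bracket_last_tree, box_one_castSucc, h]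
    let Y₁ := X₁.replug G₁ (x * y) (y * x) h₁ (fun a => by simp [add_comm])
    let Y₂ := X₂.replug G₀ (x * (z * y)) ((z * y) * x) h₂ (fun a => by simp [add_comm])
    have h₁' : Y₁.tree = plug G₀ ((y * x) * z) := by
      funext r
      by_cases h : r = k <;> simp [Y₁, Forest.replug, plug, G₀, G₁, h, z]
    have e₁ := word_antisymm G₁ hG₁ x y X₁ Y₁ h₁ rfl
    have e₂ := word_antisymm G₀ hG₀ x (z * y) X₂ Y₂ h₂ rfl
    have e₃ := word_jacobi G₀ hG₀ x z y X₃ Y₂ Y₁ h₃ rfl h₁'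
    have e : word X₁ + word X₂ = word X₃ := by
      rw [eq_neg_of_add_eq_zero_left e₁, eq_neg_of_add_eq_zero_left e₂, add_assoc] at *
      rw [eq_neg_of_add_eq_zero_left e₃]
      abel
    change word X₁ + R + word X₂ = word X₃ + R
    rw [← e]
    abel
  · intro i hi
    have hi := Finset.ne_of_mem_erase hi
    congr 1
    refine Forest.ext (funext fun r => ?_)
    by_cases h : r = k
    · subst h
      simp [Forest.comp, bracket_last_tree, box_one_castSucc, hi.symm, 
        (Fin.castSucc_lt_last _).ne']
    · by_cases h' : r = i
      · subst h'
        simp [Forest.comp, bracket_last_tree, box_one_castSucc, box_one_last, h]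
      · simp [Forest.comp, bracket_last_tree, box_one_castSucc, h, h']

/-- Centrality of the elements `μ(N)`. -/
theorem mu_central {m n : ℕ} (f : HomSpace m n) :
    compHom (m + 1) m n f (mu m) = compHom (m + 1) (n + 1) n (mu n) (boxHom 1 m n f) := by
  induction f using homSpace_induction with
  | h0 => simp
  | hadd x y hx hy => simp only [map_add, LinearMap.add_apply, hx, hy]
  | hw r F =>
    simp only [map_smul, LinearMap.smul_apply]
    congr 1
    refine Forest.induction (P := fun {m n} f => compHom (m + 1) m n f (mu m) =
      compHom (m + 1) (n + 1) n (mu n) (boxHom 1 m n f)) mu_perm mu_bracket ?_ F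
    intro a b c f g hf hg
    rw [compHom_assoc, hf, ← compHom_assoc, hg, compHom_assoc, boxHom_comp]

/-- The Chevalley–Eilenberg differential on tensors, as a word operation
`m ⊗ x_0 ⊗ ⋯ ⊗ x_t ↦ ∑_j (-1)^j (m·x_j ⊗ ⋯ x̂_j ⋯ + ∑_{i<j} m ⊗ ⋯ [x_i, x_j] ⋯ x̂_j ⋯)` where
`m` is a tensor of length `n`, acted on by the tensor product of the right adjoint actions, and
`[x_i, x_j]` takes the place of `x_i`. -/
def ceDiff (n t : ℕ) : HomSpace (n + t + 1) (n + t) :=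
  ∑ j : Fin (t + 1), (-1 : ℚ) ^ (j : ℕ) •
    ∑ i : Fin (n + t), if (i : ℕ) < n + j then word (Forest.bracket i (Fin.natAdd n j)) else 0

theorem ceDiff_zero (n : ℕ) : ceDiff n 0 = mu n := by
  refine (Fin.sum_univ_one _).trans ?_
  rw [Fin.val_zero, pow_zero, one_smul]
  refine Finset.sum_congr rfl fun i _ => ?_
  rw [if_pos (by simp)]
  rfl

theorem ceDiff_succ (n t : ℕ) : ceDiff n (t + 1) =
    boxHom 1 _ _ (ceDiff n t) + (-1 : ℚ) ^ (t + 1) • mu (n + t + 1) := by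
  rw [ceDiff, Fin.sum_univ_castSucc]
  congr 1
  · rw [ceDiff, map_sum]
    refine Finset.sum_congr rfl fun j _ => ?_
    rw [map_smul, map_sum]
    congr 1
    refine (Fin.sum_univ_castSucc (n := n + t) _).trans ?_
    have : ¬ (n + t < n + (j : ℕ)) := by omega
    simp only [Fin.val_castSucc, Fin.val_last, if_neg this, add_zero]
    refine Finset.sum_congr rfl fun i _ => ?_
    split_ifs
    · rw [boxHom_word, bracket_box]; rfl
    · rw [map_zero]
  · rw [Fin.val_last]
    congr 1
    refine Finset.sum_congr rfl fun i _ => ?_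
    rw [if_pos (by simp)]
    rfl

theorem boxHom_zero {n n' : ℕ} (f : HomSpace n n') : boxHom 0 n n' f = f := by
  induction f using homSpace_induction with
  | h0 => simp
  | hadd x y hx hy => rw [map_add, hx, hy]
  | hw r F =>
    rw [map_smul, boxHom_word]
    congr 2
    refine Forest.ext (funext fun i => ?_)
    have : (F.box 0).tree (Fin.castAdd 0 i) = FreeMagma.map (Fin.castAdd 0) (F.tree i) := by
      simp only [Forest.box, Fin.addCases_left]
    exact Eq.trans this (lift_of_eq _)

theorem step_natural {p q : ℕ} (f : HomSpace p q) (D : HomSpace (p + 1) p) (D' : HomSpace (q + 1) q)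
    (c : ℚ) (h : compHom (p + 1) p q f D = compHom (p + 1) (q + 1) q D' (boxHom 1 p q f)) :
    compHom (p + 1 + 1) (p + 1) (q + 1) (boxHom 1 p q f) (boxHom 1 _ _ D + c • mu (p + 1)) =
      compHom (p + 1 + 1) (q + 1 + 1) (q + 1) (boxHom 1 _ _ D' + c • mu (q + 1))
        (boxHom 1 _ _ (boxHom 1 p q f)) := by
  simp only [map_add, map_smul, LinearMap.add_apply, LinearMap.smul_apply]
  rw [mu_central, ← boxHom_comp, ← boxHom_comp, h]

theorem ceDiff_natural {n n' : ℕ} (f : HomSpace n n') (t : ℕ) :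
    compHom (n + t + 1) (n + t) (n' + t) (boxHom t n n' f) (ceDiff n t) =
      compHom (n + t + 1) (n' + t + 1) (n' + t) (ceDiff n' t)
        (boxHom 1 _ _ (boxHom t n n' f)) := by
  induction t with
  | zero =>
    rw [ceDiff_zero, ceDiff_zero, boxHom_zero]
    exact mu_central f
  | succ t ih =>
    rw [ceDiff_succ, ceDiff_succ, ← boxHom_boxHom t]
    exact step_natural (boxHom t n n' f) (ceDiff n t) (ceDiff n' t) _ ih

theorem step_comp {p : ℕ} (D : HomSpace (p + 1) p) (D' : HomSpace (p + 2) (p + 1))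
    (D'' : HomSpace (p + 3) (p + 2)) (k : ℕ)
    (h : compHom _ _ _ D D' = 0)
    (h' : D' = boxHom 1 _ _ D + (-1 : ℚ) ^ k • mu (p + 1))
    (h'' : D'' = boxHom 1 _ _ D' + (-1 : ℚ) ^ (k + 1) • mu (p + 2)) :
    compHom _ _ _ D' D'' = 0 := by
  have e : compHom (p + 3) (p + 2) (p + 1) D' (boxHom 1 _ _ D') =
      (-1 : ℚ) ^ k • compHom (p + 3) (p + 2) (p + 1) (mu (p + 1)) (boxHom 1 _ _ D') := by
    conv_lhs => enter [1, 2]; rw [h']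
    have e₀ : compHom (p + 3) (p + 2) (p + 1) (boxHom 1 _ _ D) (boxHom 1 _ _ D') = 0 := by
      have := boxHom_comp 1 D' D
      rw [h, map_zero] at this
      exact this.symm
    rw [map_add, LinearMap.add_apply, e₀, zero_add, map_smul, LinearMap.smul_apply]
  rw [h'', map_add, map_smul, mu_central, e, pow_succ]
  simp

theorem ceDiff_ceDiff (n t : ℕ) :
    compHom (n + t + 2) (n + t + 1) (n + t) (ceDiff n t) (ceDiff n (t + 1)) = 0 := by
  induction t with
  | zero =>
    rw [ceDiff_succ, map_add, map_smul, mu_central, ceDiff_zero]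
    simp
  | succ t ih =>
    exact step_comp (ceDiff n t) (ceDiff n (t + 1)) (ceDiff n (t + 1 + 1)) (t + 1) ih
      (ceDiff_succ n t) (ceDiff_succ n (t + 1))

/-- The permutation of `n + t` letters given by a permutation of the last `t` letters. -/
def lastPerm (n : ℕ) {t : ℕ} (σ : Equiv.Perm (Fin t)) : Equiv.Perm (Fin (n + t)) :=
  finSumFinEquiv.permCongr (Equiv.sumCongr (Equiv.refl (Fin n)) σ)

@[simp] theorem lastPerm_castAdd (n : ℕ) {t : ℕ} (σ : Equiv.Perm (Fin t)) (i : Fin n) :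
    lastPerm n σ (Fin.castAdd t i) = Fin.castAdd t i := by
  simp [lastPerm, Equiv.permCongr_apply]

@[simp] theorem lastPerm_natAdd (n : ℕ) {t : ℕ} (σ : Equiv.Perm (Fin t)) (i : Fin t) :
    lastPerm n σ (Fin.natAdd n i) = Fin.natAdd n (σ i) := by
  simp [lastPerm, Equiv.permCongr_apply]

theorem lastPerm_mul (n : ℕ) {t : ℕ} (σ τ : Equiv.Perm (Fin t)) :
    lastPerm n (σ * τ) = lastPerm n σ * lastPerm n τ := by
  refine Equiv.ext fun i => ?_
  induction i using Fin.addCases <;> simp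

theorem lastPerm_one (n t : ℕ) : lastPerm n (1 : Equiv.Perm (Fin t)) = 1 := by
  refine Equiv.ext fun i => ?_
  induction i using Fin.addCases <;> simp

theorem lastPerm_symm (n : ℕ) {t : ℕ} (σ : Equiv.Perm (Fin t)) :
    (lastPerm n σ).symm = lastPerm n σ.symm := by
  refine Equiv.ext fun i => ?_
  rw [Equiv.symm_apply_eq]
  induction i using Fin.addCases <;> simp

theorem lastPerm_swap (n : ℕ) {t : ℕ} (i j : Fin t) :
    lastPerm n (Equiv.swap i j) = Equiv.swap (Fin.natAdd n i) (Fin.natAdd n j) := by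
  refine Equiv.ext fun k => ?_
  induction k using Fin.addCases with
  | left k =>
    rw [lastPerm_castAdd, Equiv.swap_apply_of_ne_of_ne] <;> simp [Fin.ext_iff] <;> omega
  | right k =>
    rw [lastPerm_natAdd]
    simp only [Equiv.swap_apply_def, Fin.natAdd_inj]
    split_ifs <;> rfl

/-- Permuting the last `t` letters, as an endomorphism of `n + t`. -/
def permWord (n : ℕ) {t : ℕ} (σ : Equiv.Perm (Fin t)) : HomSpace (n + t) (n + t) :=
  word (Forest.perm (lastPerm n σ))

theorem boxHom_permWord {n n' : ℕ} (f : HomSpace n n') {t : ℕ} (σ : Equiv.Perm (Fin t)) :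
    compHom (n + t) (n + t) (n' + t) (boxHom t n n' f) (permWord n σ) =
      compHom (n + t) (n' + t) (n' + t) (permWord n' σ) (boxHom t n n' f) := by
  induction f using homSpace_induction with
  | h0 => simp
  | hadd x y hx hy => simp only [map_add, LinearMap.add_apply, hx, hy]
  | hw r F =>
    simp only [map_smul, LinearMap.smul_apply, boxHom_word, permWord, compHom_word]
    congr 2
    refine Forest.ext (funext fun i => ?_)
    rw [Forest.perm_comp_tree, Forest.comp_perm_tree, lastPerm_symm, lastPerm_symm]
    beta_reduce
    induction i using Fin.addCases with
    | left i =>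
      rw [lastPerm_castAdd]
      simp only [Forest.box, Fin.addCases_left, map_eq_lift, lift_lift, FreeMagma.lift_of,
        lastPerm_castAdd]
    | right i =>
      rw [lastPerm_natAdd]
      simp only [Forest.box, Fin.addCases_right, FreeMagma.map_of, lastPerm_natAdd]

/-- The sign relations `σ · ψ = sgn(σ) ψ` in the last `t` outputs; the quotient by them is the
`t`-th exterior power on these outputs. -/
def signRel (a n t : ℕ) : Submodule ℚ (HomSpace a (n + t)) :=
  Submodule.span ℚ {x | ∃ (σ : Equiv.Perm (Fin t)) (ψ : HomSpace a (n + t)),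
    x = compHom a (n + t) (n + t) (permWord n σ) ψ - ((Equiv.Perm.sign σ : ℤ) : ℚ) • ψ}

theorem signRel_precomp {a b : ℕ} (n t : ℕ) (f : HomSpace a b) :
    signRel b n t ≤ (signRel a n t).comap ((compHom a b (n + t)).flip f) := by
  refine Submodule.span_le.2 ?_
  rintro _ ⟨σ, ψ, rfl⟩
  refine Submodule.subset_span ⟨σ, compHom a b (n + t) ψ f, ?_⟩
  simp only [LinearMap.flip_apply, map_sub, map_smul, compHom_assoc]

theorem signRel_postcomp {n n' : ℕ} (a t : ℕ) (f : HomSpace n n') :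
    signRel a n t ≤ (signRel a n' t).comap (compHom a (n + t) (n' + t) (boxHom t n n' f)) := by
  refine Submodule.span_le.2 ?_
  rintro _ ⟨σ, ψ, rfl⟩
  refine Submodule.subset_span ⟨σ, compHom a (n + t) (n' + t) (boxHom t n n' f) ψ, ?_⟩
  rw [map_sub, map_smul, ← compHom_assoc, ← compHom_assoc, boxHom_permWord]

theorem permWord_mem {a n t : ℕ} (i : Fin t) (ψ : HomSpace a (n + (t + 1))) :
    compHom a _ _ (permWord n (Equiv.swap i.castSucc i.succ)) ψ + ψ ∈ signRel a n (t + 1) := by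
  refine Submodule.subset_span ⟨Equiv.swap i.castSucc i.succ, ψ, ?_⟩
  rw [Equiv.Perm.sign_swap (Fin.castSucc_lt_succ).ne]
  simp

/-- A permutation of `t` letters extended by a fixed last letter. -/
theorem exists_extend {t : ℕ} (σ : Equiv.Perm (Fin t)) : ∃ τ : Equiv.Perm (Fin (t + 1)),
    (∀ i : Fin t, τ i.castSucc = (σ i).castSucc) ∧ τ (Fin.last t) = Fin.last t ∧
      Equiv.Perm.sign τ = Equiv.Perm.sign σ := by
  refine ⟨finSumFinEquiv.permCongr (Equiv.sumCongr σ (Equiv.refl (Fin 1))), ?_, ?_, ?_⟩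
  · intro i
    have : finSumFinEquiv.symm (Fin.castAdd 1 i) = Sum.inl i := by simp
    rw [Equiv.permCongr_apply]
    erw [this]
    rfl
  · have : finSumFinEquiv.symm (Fin.natAdd t (0 : Fin 1)) = Sum.inr 0 := by simp
    rw [Equiv.permCongr_apply]
    erw [this]
    rfl
  · rw [Equiv.Perm.sign_permCongr]
    have := Equiv.Perm.sign_sumCongr σ (Equiv.refl (Fin 1))
    simpa using this

theorem boxHom_one_permWord (n : ℕ) {t : ℕ} (σ : Equiv.Perm (Fin t)) (τ : Equiv.Perm (Fin (t + 1)))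
    (h : ∀ i : Fin t, τ i.castSucc = (σ i).castSucc) (hl : τ (Fin.last t) = Fin.last t) :
    boxHom 1 _ _ (permWord n σ) = permWord n τ := by
  have hs : ∀ i : Fin t, τ.symm i.castSucc = (σ.symm i).castSucc := fun i => by
    rw [Equiv.symm_apply_eq, h, Equiv.apply_symm_apply]
  have hls : τ.symm (Fin.last t) = Fin.last t := by rw [Equiv.symm_apply_eq, hl]
  rw [permWord, boxHom_word]
  refine congrArg word (Forest.ext (funext fun i => ?_))
  change ((Forest.perm (lastPerm n σ)).box 1).tree i =
    FreeMagma.of ((lastPerm n τ).symm i)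
  rw [lastPerm_symm]
  induction i using Fin.lastCases with
  | last =>
    rw [box_one_last]
    have := lastPerm_natAdd n τ.symm (Fin.last t)
    rw [hls] at this
    exact congrArg FreeMagma.of this.symm
  | cast i =>
    rw [box_one_castSucc]
    change FreeMagma.of ((lastPerm n σ).symm i).castSucc = _
    rw [lastPerm_symm]
    refine congrArg FreeMagma.of ?_
    induction i using Fin.addCases with
    | left i =>
      rw [lastPerm_castAdd]
      exact (lastPerm_castAdd n τ.symm i).symm
    | right i =>
      rw [lastPerm_natAdd]
      have := lastPerm_natAdd n τ.symm i.castSucc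
      rw [hs] at this
      exact this.symm

theorem boxHom_signRel {a n t : ℕ} (x : HomSpace a (n + t)) (hx : x ∈ signRel a n t) :
    boxHom 1 _ _ x ∈ signRel (a + 1) n (t + 1) := by
  have : signRel a n t ≤ (signRel (a + 1) n (t + 1)).comap (boxHom 1 a (n + t)) := by
    refine Submodule.span_le.2 ?_
    rintro _ ⟨σ, ψ, rfl⟩
    obtain ⟨τ, h, hl, hs⟩ := exists_extend σ
    refine Submodule.subset_span ⟨τ, boxHom 1 a (n + t) ψ, ?_⟩
    rw [map_sub, map_smul, boxHom_comp, hs, boxHom_one_permWord n σ τ h hl]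
    rfl
  exact this hx

/-- The transposition of the last two letters. -/
def lastSwap (p : ℕ) : HomSpace (p + 2) (p + 2) :=
  word (Forest.perm (Equiv.swap (Fin.last p).castSucc (Fin.last (p + 1))))

theorem mu_swap (p : ℕ) : 
    compHom (p + 2) (p + 2) (p + 1) (boxHom 1 _ _ (mu p) - mu (p + 1)) (lastSwap p) +
      (boxHom 1 _ _ (mu p) - mu (p + 1)) = 0 := by
  have e₁ : boxHom 1 _ _ (mu p) =
      ∑ i : Fin p, word (Forest.bracket i.castSucc (Fin.last p).castSucc) := by
    simp [mu, bracket_box]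
  have e₂ : mu (p + 1) = ∑ i : Fin p, word (Forest.bracket i.castSucc (Fin.last (p + 1))) +
      word (Forest.bracket (Fin.last p) (Fin.last (p + 1))) := Fin.sum_univ_castSucc _
  have hne : ∀ i : Fin p, i.castSucc ≠ Fin.last p := fun i => (Fin.castSucc_lt_last i).ne
  have hsl : (Fin.last p).castSucc.succAbove (Fin.last p) = Fin.last (p + 1) := by
    rw [Fin.succAbove_of_le_castSucc _ _ le_rfl, Fin.succ_last]
  have hsc : ∀ i : Fin p, (Fin.last p).castSucc.succAbove i.castSucc = i.castSucc.castSucc :=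
    fun i => by
      rw [Fin.succAbove_of_castSucc_lt]
      simpa using Fin.castSucc_lt_last i
  have hsw : ∀ i : Fin p, Equiv.swap (Fin.last p).castSucc (Fin.last (p + 1)) i.castSucc.castSucc =
      i.castSucc.castSucc := fun i => by
    rw [Equiv.swap_apply_of_ne_of_ne]
    · simp [hne i]
    · exact (Fin.castSucc_lt_last _).ne
  have e₃ : ∀ i : Fin p, (Forest.perm (Equiv.swap (Fin.last p).castSucc (Fin.last (p + 1)))).comp
      (Forest.bracket i.castSucc (Fin.last p).castSucc) =
      Forest.bracket i.castSucc (Fin.last (p + 1)) := by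
    intro i
    refine Forest.ext (funext fun k => ?_)
    rw [Forest.perm_comp_tree, bracket_last_tree]
    beta_reduce
    rw [Equiv.symm_swap]
    induction k using Fin.lastCases with
    | last => simp [Forest.bracket, (hne i).symm, hsl]
    | cast k =>
      by_cases h : k = i
      · subst h; simp [Forest.bracket, hsc, hsw]
      · simp [Forest.bracket, hsc, hsw, h]
  have e₄ : ∀ i : Fin p, (Forest.perm (Equiv.swap (Fin.last p).castSucc (Fin.last (p + 1)))).comp
      (Forest.bracket i.castSucc (Fin.last (p + 1))) =
      Forest.bracket i.castSucc (Fin.last p).castSucc := by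
    intro i
    rw [← e₃, ← Forest.comp_assoc, Forest.perm_comp]
    have : (Equiv.swap (Fin.last p).castSucc (Fin.last (p + 1))).trans
      (Equiv.swap (Fin.last p).castSucc (Fin.last (p + 1))) = Equiv.refl _ := by
      ext; simp
    rw [this, Forest.perm_refl_comp]
  have e₅ : word ((Forest.perm (Equiv.swap (Fin.last p).castSucc (Fin.last (p + 1)))).comp
      (Forest.bracket (Fin.last p) (Fin.last (p + 1)))) +
      word (Forest.bracket (Fin.last p) (Fin.last (p + 1))) = 0 := by
    refine word_antisymm (fun k => if k = Fin.last p then FreeMagma.of none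
      else FreeMagma.of (some k.castSucc)) ?_ (FreeMagma.of (Fin.last (p + 1)))
      (FreeMagma.of (Fin.last p).castSucc) _ _ ?_ ?_
    · have : ∀ k : Fin (p + 1), leafCount none (if k = Fin.last p then FreeMagma.of none
        else FreeMagma.of (some k.castSucc)) = if k = Fin.last p then 1 else 0 := fun k => by
          by_cases h : k = Fin.last p <;> simp [h]
      simp [this]
    · funext k
      rw [Forest.perm_comp_tree]
      beta_reduce
      rw [bracket_last_tree, Equiv.symm_swap]
      induction k using Fin.lastCases with
      | last => simp [plug]
      | cast k => simp [plug, hne, hsw]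
    · funext k
      rw [bracket_last_tree]
      induction k using Fin.lastCases with
      | last => simp [plug]
      | cast k => simp [plug, hne]
  rw [e₁, e₂, lastSwap]
  simp only [map_sub, map_add, map_sum, LinearMap.sub_apply, LinearMap.add_apply,
    LinearMap.sum_apply, compHom_word, e₃, e₄]
  rw [eq_neg_of_add_eq_zero_left e₅]
  abel

theorem boxHom_two_lastSwap {p : ℕ} (f : HomSpace (p + 1) p) :
    compHom (p + 3) (p + 3) (p + 2) (boxHom 1 _ _ (boxHom 1 _ _ f)) (lastSwap (p + 1)) =
      compHom (p + 3) (p + 2) (p + 2) (lastSwap p) (boxHom 1 _ _ (boxHom 1 _ _ f)) := by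
  have e : ∀ q : ℕ, lastSwap q = permWord q (Equiv.swap (0 : Fin 2) 1) := fun q => by
    rw [permWord, lastPerm_swap]; rfl
  have e' : boxHom 1 (p + 2) (p + 1) (boxHom 1 (p + 1) p f) = boxHom 2 (p + 1) p f :=
    boxHom_boxHom 1 (p + 1) p f
  rw [e', e, e]
  exact boxHom_permWord (t := 2) f _

theorem permWord_lastSwap (n t : ℕ) :
    permWord n (Equiv.swap (Fin.last t).castSucc (Fin.last t).succ) = lastSwap (n + t) := by
  rw [permWord, lastPerm_swap]
  rfl

theorem ceDiff_lastSwap (n t : ℕ) :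
    compHom (n + t + 2) (n + t + 2) (n + t + 1) (ceDiff n (t + 1)) (lastSwap (n + t)) +
      ceDiff n (t + 1) ∈ signRel (n + t + 2) n (t + 1) := by
  obtain ⟨X, hX, hm⟩ : ∃ X : HomSpace (n + t + 1) (n + t),
      ceDiff n t = X + (-1 : ℚ) ^ t • mu (n + t) ∧
      compHom (n + t + 2) (n + t + 2) (n + t + 1) (boxHom 1 _ _ X) (lastSwap (n + t)) +
        boxHom 1 _ _ X ∈ signRel (n + t + 2) n (t + 1) := by
    cases t with
    | zero =>
      refine ⟨0, ?_, ?_⟩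
      · rw [ceDiff_zero, pow_zero, one_smul, zero_add]; rfl
      · simp
    | succ t =>
      refine ⟨boxHom 1 _ _ (ceDiff n t), ceDiff_succ n t, ?_⟩
      have h := boxHom_two_lastSwap (ceDiff n t)
      have h' := permWord_mem (Fin.last t) (boxHom 1 _ _ (boxHom 1 _ _ (ceDiff n t)))
      rw [permWord_lastSwap] at h'
      refine (congrArg (· ∈ signRel (n + (t + 1) + 2) n (t + 1 + 1))
        (congrArg (· + boxHom 1 _ _ (boxHom 1 _ _ (ceDiff n t))) h)).mpr h'
  have hD : ceDiff n (t + 1) =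
      boxHom 1 _ _ X + (-1 : ℚ) ^ t • (boxHom 1 _ _ (mu (n + t)) - mu (n + t + 1)) := by
    rw [ceDiff_succ, hX, map_add, map_smul, pow_succ, smul_sub]
    simp
    abel
  have hmu := congrArg ((-1 : ℚ) ^ t • ·) (mu_swap (n + t))
  rw [hD, map_add, LinearMap.add_apply, map_smul, LinearMap.smul_apply]
  convert hm using 1
  simp only [smul_add, smul_zero] at hmu
  rw [add_add_add_comm, hmu, add_zero]

theorem step_swap {p : ℕ} (D : HomSpace (p + 1) p) (P : HomSpace (p + 1) (p + 1)) (c : ℚ) :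
    compHom (p + 2) (p + 2) (p + 1) (boxHom 1 _ _ D + c • mu (p + 1)) (boxHom 1 _ _ P) +
      (boxHom 1 _ _ D + c • mu (p + 1)) =
      boxHom 1 _ _ (compHom _ _ _ D P + D) +
        c • (compHom _ _ _ P (mu (p + 1)) + mu (p + 1)) := by
  have := boxHom_comp 1 P D
  rw [map_add, map_add, LinearMap.add_apply, this, map_smul, LinearMap.smul_apply, mu_central,
    smul_add]
  abel

theorem ceDiff_swap (n t : ℕ) (i : Fin t) :
    compHom (n + t + 1) (n + t + 1) (n + t) (ceDiff n t)
      (permWord n (t := t + 1) (Equiv.swap i.castSucc i.succ)) +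
      ceDiff n t ∈ signRel (n + t + 1) n t := by
  induction t with
  | zero => exact i.elim0
  | succ t ih =>
    induction i using Fin.lastCases with
    | last =>
      refine (congrArg (· ∈ signRel (n + (t + 1) + 1) n (t + 1))
        (congrArg (· + ceDiff n (t + 1)) (congrArg (compHom (n + t + 2) (n + t + 2) (n + t + 1)
          (ceDiff n (t + 1))) (permWord_lastSwap n t)))).mpr (ceDiff_lastSwap n t)
    | cast i =>
      have e : boxHom 1 (n + t + 1) (n + t + 1)
          (permWord n (t := t + 1) (Equiv.swap i.castSucc i.succ)) =
          permWord n (t := t + 2) (Equiv.swap i.castSucc.castSucc i.castSucc.succ) := by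
        refine boxHom_one_permWord n _ _ ?_ ?_
        · intro k
          rw [Fin.succ_castSucc, Equiv.swap_apply_def, Equiv.swap_apply_def]
          simp only [Fin.castSucc_inj]
          split_ifs <;> rfl
        · rw [Equiv.swap_apply_of_ne_of_ne]
          · exact (Fin.castSucc_lt_last _).ne'
          · rw [Fin.succ_castSucc]; exact (Fin.castSucc_lt_last _).ne'
      have h := step_swap (ceDiff n t) (permWord n (t := t + 1) (Equiv.swap i.castSucc i.succ))
        ((-1 : ℚ) ^ (t + 1))
      rw [← ceDiff_succ, e] at h
      refine (congrArg (· ∈ signRel (n + (t + 1) + 1) n (t + 1)) h).mpr ?_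
      exact add_mem (boxHom_signRel _ (ih i)) (Submodule.smul_mem _ _ (permWord_mem i _))

theorem permWord_mul (n : ℕ) {t : ℕ} (σ τ : Equiv.Perm (Fin t)) :
    permWord n (σ * τ) = compHom _ _ _ (permWord n σ) (permWord n τ) := by
  rw [permWord, permWord, permWord, compHom_word, lastPerm_mul]
  rfl

theorem ceDiff_sign (n t : ℕ) (σ : Equiv.Perm (Fin (t + 1))) :
    compHom (n + t + 1) (n + t + 1) (n + t) (ceDiff n t) (permWord n (t := t + 1) σ) -
      ((Equiv.Perm.sign σ : ℤ) : ℚ) • ceDiff n t ∈ signRel (n + t + 1) n t := by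
  have hσ : σ ∈ Submonoid.closure (Set.range fun i : Fin t => Equiv.swap i.castSucc i.succ) := by
    rw [Equiv.Perm.mclosure_swap_castSucc_succ]; trivial
  induction hσ using Submonoid.closure_induction with
  | mem x hx =>
    obtain ⟨i, rfl⟩ := hx
    beta_reduce
    rw [Equiv.Perm.sign_swap (Fin.castSucc_lt_succ).ne]
    simpa using ceDiff_swap n t i
  | one =>
    have : permWord n (1 : Equiv.Perm (Fin (t + 1))) = word (Forest.perm (Equiv.refl _)) := by
      rw [permWord, lastPerm_one]; rfl
    refine (congrArg (· ∈ signRel (n + t + 1) n t) ?_).mpr (Submodule.zero_mem _)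
    rw [map_one, Units.val_one, Int.cast_one, one_smul, sub_eq_zero]
    refine (congrArg (compHom (n + t + 1) (n + t + 1) (n + t) (ceDiff n t)) this).trans ?_
    exact Category.id_comp (X := CatLie.mk (n + t + 1)) (Y := CatLie.mk (n + t)) (ceDiff n t)
  | mul σ τ _ _ hσ hτ =>
    have h1 := signRel_precomp n t (permWord n (t := t + 1) τ) hσ
    have h2 := Submodule.smul_mem _ ((Equiv.Perm.sign σ : ℤ) : ℚ) hτ
    refine (congrArg (· ∈ signRel (n + t + 1) n t) ?_).mpr (add_mem (S := Submodule ℚ _) h1 h2)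
    have hm : compHom (n + t + 1) (n + t + 1) (n + t) (ceDiff n t) (permWord n (t := t + 1) (σ * τ)) =
        compHom (n + t + 1) (n + t + 1) (n + t) (compHom (n + t + 1) (n + t + 1) (n + t)
          (ceDiff n t) (permWord n (t := t + 1) σ)) (permWord n (t := t + 1) τ) := by
      rw [compHom_assoc]
      exact congrArg _ (permWord_mul n σ τ)
    rw [hm]
    have hf : ∀ x : HomSpace (n + t + 1) (n + t),
      (compHom (n + (t + 1)) (n + (t + 1)) (n + t)).flip (permWord n (t := t + 1) τ) x =
        compHom (n + t + 1) (n + t + 1) (n + t) x (permWord n (t := t + 1) τ) := fun _ => rfl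
    rw [hf, map_sub, LinearMap.sub_apply, map_smul, LinearMap.smul_apply, smul_sub, smul_smul,
      map_mul, Units.val_mul, Int.cast_mul]
    abel

theorem signRel_ceDiff (a n t : ℕ) :
    signRel a n (t + 1) ≤ (signRel a n t).comap (compHom a (n + t + 1) (n + t) (ceDiff n t)) := by
  refine Submodule.span_le.2 ?_
  rintro _ ⟨σ, ψ, rfl⟩
  have h := signRel_precomp n t ψ (ceDiff_sign n t σ)
  refine (congrArg (· ∈ signRel a n t) ?_).mpr h
  have hf : ∀ x : HomSpace (n + t + 1) (n + t),
      (compHom a (n + (t + 1)) (n + t)).flip ψ x = compHom a (n + t + 1) (n + t) x ψ :=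
    fun _ => rfl
  rw [hf, map_sub (compHom a (n + t + 1) (n + t)), LinearMap.sub_apply,
    map_smul (compHom a (n + t + 1) (n + t)), LinearMap.smul_apply, compHom_assoc]
  exact (map_sub (compHom a (n + t + 1) (n + t) (ceDiff n t)) _ _).trans
    (congrArg (_ - ·) (map_smul (compHom a (n + t + 1) (n + t) (ceDiff n t)) _ ψ))

/-- The right `CatLie`-module `a ↦ CatLie(a, n) ⊙ Λ^t(Lie)`: the quotient of `CatLie(a, n + t)` by
the sign relations in the last `t` outputs.  It corresponds to the functor
`V ↦ Lie(V)^{⊗ n} ⊗ Λ^t(Lie(V))`. -/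
def ceRight (t n : ℕ) : CatLieᵒᵖ ⥤ ModuleCat ℚ where
  obj a := ModuleCat.of ℚ (HomSpace a.unop.n (n + t) ⧸ signRel a.unop.n n t)
  map {a b} f := ModuleCat.ofHom (Submodule.mapQ (signRel a.unop.n n t) (signRel b.unop.n n t)
    ((compHom b.unop.n a.unop.n (n + t)).flip f.unop) (signRel_precomp n t f.unop))
  map_id a := by
    refine ModuleCat.hom_ext (LinearMap.ext fun x => ?_)
    obtain ⟨x, rfl⟩ := Submodule.Quotient.mk_surjective _ x
    exact congrArg Submodule.Quotient.mk
      (Category.id_comp (X := a.unop) (Y := CatLie.mk (n + t)) x)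
  map_comp {a b c} f g := by
    refine ModuleCat.hom_ext (LinearMap.ext fun x => ?_)
    obtain ⟨x, rfl⟩ := Submodule.Quotient.mk_surjective _ x
    exact congrArg Submodule.Quotient.mk (compHom_assoc g.unop f.unop x).symm

/-- The `CatLie`-bimodule which is the term of degree `t` of the universal Chevalley–Eilenberg
complex; `f : n ⟶ n'` acts on the left through `f ⊞ t`. -/
def ceTerm (t : ℕ) : CatLie ⥤ CatLieᵒᵖ ⥤ ModuleCat ℚ where
  obj n := ceRight t n.n
  map {n n'} f :=
    { app := fun a => ModuleCat.ofHom (Submodule.mapQ (signRel a.unop.n n.n t)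
        (signRel a.unop.n n'.n t)
        (compHom a.unop.n (n.n + t) (n'.n + t) (boxHom t n.n n'.n f))
        (signRel_postcomp a.unop.n t f))
      naturality := fun a b g => by
        ext x
        obtain ⟨x, rfl⟩ := Submodule.Quotient.mk_surjective _ x
        exact congrArg Submodule.Quotient.mk (compHom_assoc g.unop x (boxHom t n.n n'.n f)).symm }
  map_id n := by
    ext a x
    obtain ⟨x, rfl⟩ := Submodule.Quotient.mk_surjective _ x
    refine congrArg Submodule.Quotient.mk ?_
    refine (congrArg (fun y => compHom a.unop.n (n.n + t) (n.n + t) y x)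
      ((box t).map_id n)).trans ?_
    exact Category.comp_id (X := a.unop) (Y := CatLie.mk (n.n + t)) x
  map_comp {n n' n''} f g := by
    ext a x
    obtain ⟨x, rfl⟩ := Submodule.Quotient.mk_surjective _ x
    refine congrArg Submodule.Quotient.mk ?_
    refine (congrArg (fun y => compHom a.unop.n (n.n + t) (n''.n + t) y x)
      (boxHom_comp t f g)).trans ?_
    exact compHom_assoc _ _ _

/-- The differential of the universal Chevalley–Eilenberg complex. -/
def ceD (t : ℕ) : ceTerm (t + 1) ⟶ ceTerm t where
  app n :=
    { app := fun a => ModuleCat.ofHom (Submodule.mapQ (signRel a.unop.n n.n (t + 1))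
        (signRel a.unop.n n.n t)
        (compHom a.unop.n (n.n + t + 1) (n.n + t) (ceDiff n.n t)) (signRel_ceDiff a.unop.n n.n t))
      naturality := fun a b g => by
        ext x
        obtain ⟨x, rfl⟩ := Submodule.Quotient.mk_surjective _ x
        exact congrArg Submodule.Quotient.mk (compHom_assoc g.unop x (ceDiff n.n t)).symm }
  naturality n n' f := by
    ext a x
    obtain ⟨x, rfl⟩ := Submodule.Quotient.mk_surjective _ x
    refine congrArg Submodule.Quotient.mk ?_
    have h := ceDiff_natural f t
    rw [boxHom_boxHom] at h
    have h' := congrArg (fun y => compHom a.unop.n (n.n + t + 1) (n'.n + t) y x) h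
    beta_reduce at h'
    rw [compHom_assoc, compHom_assoc] at h'
    exact h'.symm

theorem ceD_comp (t : ℕ) : ceD (t + 1) ≫ ceD t = 0 := by
  ext n a x
  obtain ⟨x, rfl⟩ := Submodule.Quotient.mk_surjective _ x
  have h := congrArg (fun y => compHom a.unop.n (n.n + t + 2) (n.n + t) y x)
    (ceDiff_ceDiff n.n t)
  beta_reduce at h
  rw [compHom_assoc, map_zero, LinearMap.zero_apply] at h
  exact congrArg Submodule.Quotient.mk h

/-- The universal Chevalley–Eilenberg complex, a complex of `CatLie`-bimodules. -/
def CE : ChainComplex (CatLie ⥤ CatLieᵒᵖ ⥤ ModuleCat ℚ) ℕ :=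
  ChainComplex.of ceTerm ceD ceD_comp

/-- The relations `r·f ⊗ m = r ⊗ f·m` defining the tensor product over `CatLie`. -/
def tensorRel (R : CatLieᵒᵖ ⥤ ModuleCat ℚ) (M : CatLie ⥤ ModuleCat ℚ) :
    Submodule ℚ (DirectSum ℕ fun a => R.obj (op ⟨a⟩) ⊗[ℚ] M.obj ⟨a⟩) :=
  Submodule.span ℚ {x | ∃ (a b : ℕ) (f : CatLie.mk a ⟶ CatLie.mk b) (r : R.obj (op ⟨b⟩))
    (m : M.obj ⟨a⟩),
    x = DirectSum.lof ℚ ℕ (fun a => R.obj (op ⟨a⟩) ⊗[ℚ] M.obj ⟨a⟩) a (R.map f.op r ⊗ₜ m) -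
      DirectSum.lof ℚ ℕ (fun a => R.obj (op ⟨a⟩) ⊗[ℚ] M.obj ⟨a⟩) b (r ⊗ₜ M.map f m)}

/-- Functoriality of `⨁ a, R(a) ⊗ M(a)`. -/
def sumMap {R R' : CatLieᵒᵖ ⥤ ModuleCat ℚ} {M M' : CatLie ⥤ ModuleCat ℚ} (α : R ⟶ R')
    (β : M ⟶ M') :
    (DirectSum ℕ fun a => R.obj (op ⟨a⟩) ⊗[ℚ] M.obj ⟨a⟩) →ₗ[ℚ]
      DirectSum ℕ fun a => R'.obj (op ⟨a⟩) ⊗[ℚ] M'.obj ⟨a⟩ :=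
  DirectSum.lmap fun a => TensorProduct.map (α.app (op ⟨a⟩)).hom (β.app ⟨a⟩).hom

theorem tensorRel_map {R R' : CatLieᵒᵖ ⥤ ModuleCat ℚ} {M M' : CatLie ⥤ ModuleCat ℚ} (α : R ⟶ R')
    (β : M ⟶ M') : tensorRel R M ≤ (tensorRel R' M').comap (sumMap α β) := by
  refine Submodule.span_le.2 ?_
  rintro _ ⟨a, b, f, r, m, rfl⟩
  refine Submodule.subset_span ⟨a, b, f, α.app _ r, β.app _ m, ?_⟩
  have h₁ := congrArg (fun g => g.hom r) (α.naturality f.op)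
  have h₂ := congrArg (fun g => g.hom m) (β.naturality f)
  simp only [ModuleCat.hom_comp, LinearMap.comp_apply] at h₁ h₂
  simp only [sumMap, map_sub, DirectSum.lmap_lof, TensorProduct.map_tmul]
  rw [h₁, h₂]

/-- The tensor product `R ⊗_CatLie M`. -/
abbrev TensorCarrier (R : CatLieᵒᵖ ⥤ ModuleCat ℚ) (M : CatLie ⥤ ModuleCat ℚ) : Type :=
  (DirectSum ℕ fun a => R.obj (op ⟨a⟩) ⊗[ℚ] M.obj ⟨a⟩) ⧸ tensorRel R M

/-- Functoriality of `R ⊗_CatLie M`. -/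
def tensorMap {R R' : CatLieᵒᵖ ⥤ ModuleCat ℚ} {M M' : CatLie ⥤ ModuleCat ℚ} (α : R ⟶ R')
    (β : M ⟶ M') : TensorCarrier R M →ₗ[ℚ] TensorCarrier R' M' :=
  Submodule.mapQ _ _ (sumMap α β) (tensorRel_map α β)

theorem tensor_ext {R : CatLieᵒᵖ ⥤ ModuleCat ℚ} {M : CatLie ⥤ ModuleCat ℚ} {N : Type}
    [AddCommGroup N] [Module ℚ N] {f g : TensorCarrier R M →ₗ[ℚ] N}
    (h : ∀ a r m, f (Submodule.Quotient.mk (DirectSum.lof ℚ ℕ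
      (fun a => R.obj (op ⟨a⟩) ⊗[ℚ] M.obj ⟨a⟩) a (r ⊗ₜ m))) =
      g (Submodule.Quotient.mk (DirectSum.lof ℚ ℕ
      (fun a => R.obj (op ⟨a⟩) ⊗[ℚ] M.obj ⟨a⟩) a (r ⊗ₜ m)))) : f = g := by
  refine Submodule.linearMap_qext _ (DirectSum.linearMap_ext _ fun a => ?_)
  exact TensorProduct.ext' fun r m => h a r m

theorem tensorMap_mk {R R' : CatLieᵒᵖ ⥤ ModuleCat ℚ} {M M' : CatLie ⥤ ModuleCat ℚ} (α : R ⟶ R')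
    (β : M ⟶ M') (a : ℕ) (r : R.obj (op ⟨a⟩)) (m : M.obj ⟨a⟩) :
    tensorMap α β (Submodule.Quotient.mk (DirectSum.lof ℚ ℕ
      (fun a => R.obj (op ⟨a⟩) ⊗[ℚ] M.obj ⟨a⟩) a (r ⊗ₜ m))) =
    Submodule.Quotient.mk (DirectSum.lof ℚ ℕ
      (fun a => R'.obj (op ⟨a⟩) ⊗[ℚ] M'.obj ⟨a⟩) a (α.app _ r ⊗ₜ β.app _ m)) := by
  simp only [tensorMap, Submodule.mapQ_apply, sumMap, DirectSum.lmap_lof, TensorProduct.map_tmul]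

/-- The functor `- ⊗_CatLie M` from right `CatLie`-modules to vector spaces. -/
def tensorWith (M : CatLie ⥤ ModuleCat ℚ) : (CatLieᵒᵖ ⥤ ModuleCat ℚ) ⥤ ModuleCat ℚ where
  obj R := ModuleCat.of ℚ (TensorCarrier R M)
  map α := ModuleCat.ofHom (tensorMap α (𝟙 M))
  map_id R := ModuleCat.hom_ext (tensor_ext fun a r m => tensorMap_mk _ _ _ _ _)
  map_comp α β := ModuleCat.hom_ext (tensor_ext fun a r m => by
    refine (tensorMap_mk _ _ _ _ _).trans ?_
    refine Eq.trans ?_ (congrArg (tensorMap β (𝟙 M)) (tensorMap_mk α (𝟙 M) a r m)).symm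
    exact (tensorMap_mk β (𝟙 M) a (α.app _ r) ((𝟙 M : M ⟶ M).app _ m)).symm)

instance (M : CatLie ⥤ ModuleCat ℚ) : (tensorWith M).Additive where
  map_add {R R' α β} := ModuleCat.hom_ext (tensor_ext fun a r m => by
    refine (tensorMap_mk _ _ _ _ _).trans ?_
    refine Eq.trans ?_ (congrArg₂ (· + ·) (tensorMap_mk α (𝟙 M) a r m)
      (tensorMap_mk β (𝟙 M) a r m)).symm
    beta_reduce
    rw [← Submodule.Quotient.mk_add, ← map_add, ← TensorProduct.add_tmul]
    rfl)

/-- Functoriality of `- ⊗_CatLie M` in `M`. -/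
def tensorWithMap {M M' : CatLie ⥤ ModuleCat ℚ} (β : M ⟶ M') : tensorWith M ⟶ tensorWith M' where
  app R := ModuleCat.ofHom (tensorMap (𝟙 R) β)
  naturality R R' α := ModuleCat.hom_ext (tensor_ext fun a r m => by
    refine (congrArg (tensorMap (𝟙 R') β) (tensorMap_mk α (𝟙 M) a r m)).trans ?_
    refine Eq.trans ?_ (congrArg (tensorMap α (𝟙 M')) (tensorMap_mk (𝟙 R) β a r m)).symm
    exact (tensorMap_mk _ _ _ _ _).trans
      (tensorMap_mk α (𝟙 M') a ((𝟙 R : R ⟶ R).app _ r) (β.app _ m)).symm)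

/-- The complex of left `CatLie`-modules `CE ⊗_CatLie M`. -/
def ceTensor (M : CatLie ⥤ ModuleCat ℚ) : ChainComplex (CatLie ⥤ ModuleCat ℚ) ℕ :=
  (((Functor.whiskeringRight CatLie _ _).obj (tensorWith M)).mapHomologicalComplex _).obj CE

/-- Functoriality of `CE ⊗_CatLie M` in the left `CatLie`-module `M`. -/
def ceTensorMap {M M' : CatLie ⥤ ModuleCat ℚ} (β : M ⟶ M') : ceTensor M ⟶ ceTensor M' :=
  (NatTrans.mapHomologicalComplex
    ((Functor.whiskeringRight CatLie _ _).map (tensorWithMap β)) _).app CE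

/-- The left `CatLie`-module `ℚ𝔖_n` supported on `n`, i.e. `m ↦ ℚΣ(n, m)`, restricted along the
augmentation. -/
def regular (n : ℕ) : CatLie ⥤ ModuleCat ℚ :=
  aug ⋙ (linearCoyoneda ℚ (Free ℚ PermCat)).obj (op (Free.of ℚ ⟨n⟩))

/-- The right regular action of `𝔖_n` on `ℚ𝔖_n`. -/
def regularRight (n : ℕ) (τ : Equiv.Perm (Fin n)) : regular n ⟶ regular n :=
  Functor.whiskerLeft aug ((linearCoyoneda ℚ (Free ℚ PermCat)).map
    ((Free.embedding ℚ PermCat).map (X := ⟨n⟩) (Y := ⟨n⟩) τ).op)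

/-- The left `CatLie`-module `H_t(CE ⊗_CatLie ℚ𝔖_n)`. -/
def ceHomology (n t : ℕ) : CatLie ⥤ ModuleCat ℚ := (ceTensor (regular n)).homology t

/-- The right action of `𝔖_n` on `H_t(CE ⊗_CatLie ℚ𝔖_n)`. -/
def ceHomologyRight (n t : ℕ) (τ : Equiv.Perm (Fin n)) : ceHomology n t ⟶ ceHomology n t :=
  HomologicalComplex.homologyMap (ceTensorMap (regularRight n τ)) t

/-- The category `Σ` of finite sets and bijections. -/
structure FinBij where
  /-- The underlying set. -/
  carrier : Type
  [finite : Finite carrier]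

attribute [instance] FinBij.finite

instance : Category FinBij where
  Hom S T := S.carrier ≃ T.carrier
  id S := Equiv.refl _
  comp f g := f.trans g

/-- The bijection underlying a morphism. -/
def FinBij.equiv {S T : FinBij} (e : S ⟶ T) : S.carrier ≃ T.carrier := e

/-- The inclusion of the skeleton. -/
def skeleton : PermCat ⥤ FinBij where
  obj n := ⟨Fin n.n⟩
  map σ := σ

/-- A subset of a finite set. -/
def FinBij.sub (S : FinBij) (A : Set S.carrier) : FinBij := ⟨A⟩

/-- The bijection from the preimage of a subset to the subset. -/
def FinBij.restrict {S T : FinBij} (e : S ⟶ T) (A : Set T.carrier) :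
    S.sub (FinBij.equiv e ⁻¹' A) ⟶ T.sub A :=
  (FinBij.equiv e).subtypeEquiv fun _ => Iff.rfl

/-- For a finite set `S`, the right `Σ`-module `T ↦ ℚ Bij(T, S)`; for `S` the set with `m` elements
it is the right module `ℚ𝔖_m` supported on `m`, and bijections of `S` act on the left. -/
def regularBimodule : FinBij ⥤ FinBijᵒᵖ ⥤ ModuleCat ℚ :=
  yoneda ⋙ (Functor.whiskeringRight _ _ _).obj (ModuleCat.free ℚ)

/-- The relations `σ ∘ e = sgn(σ) e`. -/
def sgnRel (t : ℕ) (T : Type) : Submodule ℚ ((T ≃ Fin t) →₀ ℚ) :=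
  Submodule.span ℚ {x | ∃ (σ : Equiv.Perm (Fin t)) (e : T ≃ Fin t),
    x = Finsupp.single (e.trans σ) 1 - Finsupp.single e ((Equiv.Perm.sign σ : ℤ) : ℚ)}

theorem sgnRel_map (t : ℕ) {T T' : Type} (f : T' ≃ T) :
    sgnRel t T ≤ (sgnRel t T').comap
      (Finsupp.lmapDomain ℚ ℚ fun e : T ≃ Fin t => f.trans e) := by
  refine Submodule.span_le.2 ?_
  rintro _ ⟨σ, e, rfl⟩
  refine Submodule.subset_span ⟨σ, f.trans e, ?_⟩
  simp only [map_sub, Finsupp.lmapDomain_apply, Finsupp.mapDomain_single]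
  rfl

/-- Transport of structure along a bijection. -/
def sgnMap (t : ℕ) {T T' : Type} (f : T' ≃ T) :
    (((T ≃ Fin t) →₀ ℚ) ⧸ sgnRel t T) →ₗ[ℚ] (((T' ≃ Fin t) →₀ ℚ) ⧸ sgnRel t T') :=
  Submodule.mapQ _ _ (Finsupp.lmapDomain ℚ ℚ fun e : T ≃ Fin t => f.trans e) (sgnRel_map t f)

theorem sgnMap_mk (t : ℕ) {T T' : Type} (f : T' ≃ T) (e : T ≃ Fin t) :
    sgnMap t f (Submodule.Quotient.mk (Finsupp.single e 1)) =
      Submodule.Quotient.mk (Finsupp.single (f.trans e) 1) := by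
  rw [sgnMap, Submodule.mapQ_apply, Finsupp.lmapDomain_apply, Finsupp.mapDomain_single]

/-- The right `Σ`-module `sgn_t`, supported on sets with `t` elements: on such a set `T` it is the
quotient of `ℚ Bij(T, t)` by `σ ∘ e = sgn(σ) e`, a line on which `𝔖_t` acts by the signature when
`T = {1, …, t}`. -/
def sgn (t : ℕ) : FinBijᵒᵖ ⥤ ModuleCat ℚ where
  obj T := ModuleCat.of ℚ (((T.unop.carrier ≃ Fin t) →₀ ℚ) ⧸ sgnRel t T.unop.carrier)
  map f := ModuleCat.ofHom (sgnMap t (FinBij.equiv f.unop))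
  map_id T := ModuleCat.hom_ext (Submodule.linearMap_qext _ (Finsupp.lhom_ext' fun e =>
    LinearMap.ext_ring (sgnMap_mk t _ e)))
  map_comp f g := ModuleCat.hom_ext (Submodule.linearMap_qext _ (Finsupp.lhom_ext' fun e =>
    LinearMap.ext_ring (by
      refine (sgnMap_mk t _ e).trans ?_
      refine Eq.trans ?_ (congrArg (sgnMap t (FinBij.equiv g.unop))
        (sgnMap_mk t (FinBij.equiv f.unop) e)).symm
      exact (sgnMap_mk t (FinBij.equiv g.unop) ((FinBij.equiv f.unop).trans e)).symm)))

/-- The value `⨁_{S = A ⊔ Aᶜ} M(A) ⊗ N(Aᶜ)` of the convolution product. -/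
abbrev ConvCarrier (M N : FinBijᵒᵖ ⥤ ModuleCat ℚ) (S : FinBij) : Type :=
  DirectSum (Set S.carrier) fun A => M.obj (op (S.sub A)) ⊗[ℚ] N.obj (op (S.sub Aᶜ))

open Classical in
/-- The inclusion of a summand. -/
def convOf (M N : FinBijᵒᵖ ⥤ ModuleCat ℚ) (S : FinBij) (A : Set S.carrier) :
    M.obj (op (S.sub A)) ⊗[ℚ] N.obj (op (S.sub Aᶜ)) →ₗ[ℚ] ConvCarrier M N S :=
  DirectSum.lof ℚ (Set S.carrier)
    (fun A => M.obj (op (S.sub A)) ⊗[ℚ] N.obj (op (S.sub Aᶜ))) A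

theorem conv_ext {M N : FinBijᵒᵖ ⥤ ModuleCat ℚ} {S : FinBij} {P : Type} [AddCommGroup P]
    [Module ℚ P] {f g : ConvCarrier M N S →ₗ[ℚ] P}
    (h : ∀ A x y, f (convOf M N S A (x ⊗ₜ y)) = g (convOf M N S A (x ⊗ₜ y))) : f = g := by
  classical
  refine DirectSum.linearMap_ext _ fun A => TensorProduct.ext' fun x y => ?_
  refine Eq.trans ?_ ((h A x y).trans ?_)
  · simp only [convOf, LinearMap.comp_apply]
  · simp only [convOf, LinearMap.comp_apply]

open Classical in
/-- A bijection `e : S ⟶ T` sends the summand of `A ⊆ T` to the summand of `e⁻¹(A)`. -/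
def convMap (M N : FinBijᵒᵖ ⥤ ModuleCat ℚ) {S T : FinBij} (e : S ⟶ T) :
    ConvCarrier M N T →ₗ[ℚ] ConvCarrier M N S :=
  DirectSum.toModule ℚ (Set T.carrier) _ fun A =>
    convOf M N S (FinBij.equiv e ⁻¹' A) ∘ₗ TensorProduct.map (M.map (FinBij.restrict e A).op).hom
      (N.map (FinBij.restrict e Aᶜ).op).hom

theorem convMap_of (M N : FinBijᵒᵖ ⥤ ModuleCat ℚ) {S T : FinBij} (e : S ⟶ T) (A : Set T.carrier)
    (x : M.obj (op (T.sub A))) (y : N.obj (op (T.sub Aᶜ))) :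
    convMap M N e (convOf M N T A (x ⊗ₜ y)) = convOf M N S (FinBij.equiv e ⁻¹' A)
      (M.map (FinBij.restrict e A).op x ⊗ₜ N.map (FinBij.restrict e Aᶜ).op y) := by
  rw [convMap, convOf, DirectSum.toModule_lof]
  rfl

/-- The convolution product of right `Σ`-modules,
`(M ⊙ N)(S) = ⨁_{S = A ⊔ Aᶜ} M(A) ⊗ N(Aᶜ)`. -/
def conv (M N : FinBijᵒᵖ ⥤ ModuleCat ℚ) : FinBijᵒᵖ ⥤ ModuleCat ℚ where
  obj S := ModuleCat.of ℚ (ConvCarrier M N S.unop)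
  map e := ModuleCat.ofHom (convMap M N e.unop)
  map_id S := ModuleCat.hom_ext (conv_ext fun A x y => by
    refine (convMap_of M N _ A x y).trans ?_
    have h₁ := congrArg (fun g => g.hom x) (M.map_id (op (S.unop.sub A)))
    have h₂ := congrArg (fun g => g.hom y) (N.map_id (op (S.unop.sub Aᶜ)))
    exact congrArg (convOf M N S.unop A) (congrArg₂ (· ⊗ₜ[ℚ] ·) h₁ h₂))
  map_comp {S T U} e f := ModuleCat.hom_ext (conv_ext fun A x y => by
    refine (convMap_of M N _ A x y).trans ?_
    refine Eq.trans ?_ (congrArg (convMap M N f.unop) (convMap_of M N e.unop A x y)).symm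
    refine Eq.trans ?_ (convMap_of M N f.unop _ _ _).symm
    have h₁ := congrArg (fun g => g.hom x) (M.map_comp (FinBij.restrict e.unop A).op
      (FinBij.restrict f.unop (FinBij.equiv e.unop ⁻¹' A)).op)
    have h₂ := congrArg (fun g => g.hom y) (N.map_comp (FinBij.restrict e.unop Aᶜ).op
      (FinBij.restrict f.unop (FinBij.equiv e.unop ⁻¹' Aᶜ)).op)
    exact congrArg (convOf M N U.unop (FinBij.equiv f.unop ⁻¹' (FinBij.equiv e.unop ⁻¹' A)))
      (congrArg₂ (· ⊗ₜ[ℚ] ·) h₁ h₂))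

open Classical in
/-- Functoriality of `M ⊙ N` in `M`. -/
def convHom {M M' : FinBijᵒᵖ ⥤ ModuleCat ℚ} (α : M ⟶ M') (N : FinBijᵒᵖ ⥤ ModuleCat ℚ) (S : FinBij) :
    ConvCarrier M N S →ₗ[ℚ] ConvCarrier M' N S :=
  DirectSum.lmap fun A => TensorProduct.map (α.app (op (S.sub A))).hom LinearMap.id

theorem convHom_of {M M' : FinBijᵒᵖ ⥤ ModuleCat ℚ} (α : M ⟶ M') (N : FinBijᵒᵖ ⥤ ModuleCat ℚ)
    (S : FinBij) (A : Set S.carrier) (x : M.obj (op (S.sub A))) (y : N.obj (op (S.sub Aᶜ))) :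
    convHom α N S (convOf M N S A (x ⊗ₜ y)) = convOf M' N S A (α.app _ x ⊗ₜ y) := by
  rw [convHom, convOf, DirectSum.lmap_lof]
  rfl

/-- The functor `- ⊙ N`. -/
def convLeft (N : FinBijᵒᵖ ⥤ ModuleCat ℚ) :
    (FinBijᵒᵖ ⥤ ModuleCat ℚ) ⥤ (FinBijᵒᵖ ⥤ ModuleCat ℚ) where
  obj M := conv M N
  map {M M'} α :=
    { app := fun S => ModuleCat.ofHom (convHom α N S.unop)
      naturality := fun S T e => ModuleCat.hom_ext (conv_ext fun A x y => by
        refine (congrArg (convHom α N T.unop) (convMap_of M N e.unop A x y)).trans ?_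
        refine (convHom_of α N _ _ _ _).trans ?_
        refine Eq.trans ?_ (congrArg (convMap M' N e.unop) (convHom_of α N S.unop A x y)).symm
        refine Eq.trans ?_ (convMap_of M' N e.unop A _ y).symm
        have h := congrArg (fun g => g.hom x) (α.naturality (FinBij.restrict e.unop A).op)
        exact congrArg (convOf M' N T.unop _) (congrArg (· ⊗ₜ[ℚ] _) h)) }
  map_id M := NatTrans.ext (funext fun S => ModuleCat.hom_ext (conv_ext fun A x y =>
    convHom_of (𝟙 M) N S.unop A x y))
  map_comp α β := NatTrans.ext (funext fun S => ModuleCat.hom_ext (conv_ext fun A x y => by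
    refine (convHom_of (α ≫ β) N S.unop A x y).trans ?_
    refine Eq.trans ?_ (congrArg (convHom β N S.unop) (convHom_of α N S.unop A x y)).symm
    exact (convHom_of β N S.unop A _ y).symm))

/-- The right `Σ`-modules `ℚ𝔖_m ⊙ sgn_t`, on which `𝔖_m` acts on the left through the left regular
action on `ℚ𝔖_m`. -/
def regularConvSgn (t : ℕ) : PermCat ⥤ FinBijᵒᵖ ⥤ ModuleCat ℚ :=
  skeleton ⋙ regularBimodule ⋙ convLeft (sgn t)

end

end LieProp

/-! The homology requires no computation because the complex already has zero differential after
tensoring. For fixed `m`, the degree `t` term is a quotient of the representable right module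
`CatLie(-, m + t)`, hence is generated by the class `ceOne` of the identity. Balancing therefore
moves every tensor `ψ ⊗ x` to `ceOne ⊗ ψ·x` (`tensorMk_ceMk`), so the tensor product with `ℚ𝔖_n` is
spanned by the classes `permClass e` of bijections `e : Fin n ≃ Fin (m + t)` (`tensor_ceRight_ext`).

Whatever is moved across the tensor sign acts on `ℚ𝔖_n` only through its augmentation. The
Chevalley–Eilenberg differential is left composition with `ceDiff`, a combination of forests that
each contain a bracket, so its augmentation is zero and the differential vanishes (`tensorMap_ceD`,
`ceTensor_d`). The homology is thus the term itself, naturally in both actions (`ceHomologyIso`,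
`ceHomologyRight_iso`). In the same way a morphism `f` acts by the augmentation of `f ⊞ t`, which
depends only on that of `f` (`augHom_boxHom`). Since `f` and its image under `aug` followed by
`unit` have equal augmentations, they act equally (`ceHomology_map_eq`). When `m + t ≠ n` there are
no bijections, so the term is zero.

To identify the term, one shows that the sign relations under permutations of the last `t` letters
are the only relations among the `permClass e` (`tensorDesc`). A bijection `Fin n ≃ Fin (m + t)` is
the same thing as a subset `A` of `Fin n` with bijections of `A` onto `Fin m` and of its complement
onto `Fin t` (`glue`, `exists_glue`, `glue_inj`). These triples, modulo signs in the last component,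
also present `ℚ𝔖_m ⊙ sgn_t` (`regularConv_ext`, `regularConvDesc`). Matching the two presentations
gives `tensorEquivConv`, and equivariance on both sides is checked on generators. -/

namespace LieProp

noncomputable section

/-! ### Homology of complexes with zero differential -/

section Homology

variable {C ι : Type*} [Category C] [Abelian C] {c : ComplexShape ι}

/-- The homology of a complex with zero differentials. -/
def homologyIsoOfZero (K : HomologicalComplex C c) (h : ∀ i j, K.d i j = 0) (i : ι) :
    K.homology i ≅ K.X i :=
  -- With no boundaries, cycles map isomorphically onto homology; with no outgoing differential,
  -- every chain is a cycle.
  (K.isoHomologyπ _ i rfl (h _ _)).symm ≪≫ K.iCyclesIso i _ rfl (h _ _)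

/-- Both halves of the isomorphism are natural maps out of the cycles. This is what carries the
right action of `𝔖_n`, defined by functoriality of homology, over to the terms. -/
theorem homologyIsoOfZero_naturality {K L : HomologicalComplex C c} (φ : K ⟶ L)
    (hK : ∀ i j, K.d i j = 0) (hL : ∀ i j, L.d i j = 0) (i : ι) :
    HomologicalComplex.homologyMap φ i ≫ (homologyIsoOfZero L hL i).hom =
      (homologyIsoOfZero K hK i).hom ≫ φ.f i := by
  have h₁ : (K.isoHomologyπ _ i rfl (hK _ _)).hom ≫ HomologicalComplex.homologyMap φ i =
      HomologicalComplex.cyclesMap φ i ≫ (L.isoHomologyπ _ i rfl (hL _ _)).hom :=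
    HomologicalComplex.homologyπ_naturality φ i
  have h₂ : HomologicalComplex.cyclesMap φ i ≫ (L.iCyclesIso i _ rfl (hL _ _)).hom =
      (K.iCyclesIso i _ rfl (hK _ _)).hom ≫ φ.f i := HomologicalComplex.cyclesMap_i φ i
  simp only [homologyIsoOfZero, Iso.trans_hom, Iso.symm_hom, Category.assoc]
  rw [← h₂, Iso.eq_inv_comp, reassoc_of% h₁, Iso.hom_inv_id_assoc]

end Homology

/-! ### Generators of the tensor product with `ℚ𝔖_n` -/

/-- The class of a pure tensor in `R ⊗_CatLie M`. -/
def tensorMk (R : CatLieᵒᵖ ⥤ ModuleCat ℚ) (M : CatLie ⥤ ModuleCat ℚ) (a : ℕ)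
    (r : R.obj (op ⟨a⟩)) (x : M.obj ⟨a⟩) : TensorCarrier R M :=
  Submodule.Quotient.mk
    (DirectSum.lof ℚ ℕ (fun a => R.obj (op ⟨a⟩) ⊗[ℚ] M.obj ⟨a⟩) a (r ⊗ₜ x))

theorem tensorMk_map (R : CatLieᵒᵖ ⥤ ModuleCat ℚ) (M : CatLie ⥤ ModuleCat ℚ) {a b : ℕ}
    (f : CatLie.mk a ⟶ CatLie.mk b) (r : R.obj (op ⟨b⟩)) (x : M.obj ⟨a⟩) :
    tensorMk R M a (R.map f.op r) x = tensorMk R M b r (M.map f x) :=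
  (Submodule.Quotient.eq _).2 (Submodule.subset_span ⟨a, b, f, r, x, rfl⟩)

theorem tensorMk_add (R : CatLieᵒᵖ ⥤ ModuleCat ℚ) (M : CatLie ⥤ ModuleCat ℚ) (a : ℕ)
    (r : R.obj (op ⟨a⟩)) (x y : M.obj ⟨a⟩) :
    tensorMk R M a r (x + y) = tensorMk R M a r x + tensorMk R M a r y := by
  simp only [tensorMk, TensorProduct.tmul_add, map_add, Submodule.Quotient.mk_add]

theorem tensorMk_zero (R : CatLieᵒᵖ ⥤ ModuleCat ℚ) (M : CatLie ⥤ ModuleCat ℚ) (a : ℕ)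
    (r : R.obj (op ⟨a⟩)) : tensorMk R M a r 0 = 0 := by
  simp only [tensorMk, TensorProduct.tmul_zero, map_zero, Submodule.Quotient.mk_zero]

theorem tensorMk_smul (R : CatLieᵒᵖ ⥤ ModuleCat ℚ) (M : CatLie ⥤ ModuleCat ℚ) (a : ℕ)
    (r : R.obj (op ⟨a⟩)) (q : ℚ) (x : M.obj ⟨a⟩) :
    tensorMk R M a r (q • x) = q • tensorMk R M a r x := by
  simp only [tensorMk, TensorProduct.tmul_smul, map_smul, Submodule.Quotient.mk_smul]

/-- The generator of the right module `ceRight t m`. -/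
def ceOne (t m : ℕ) : (ceRight t m).obj (op ⟨m + t⟩) :=
  Submodule.Quotient.mk (word (Forest.perm (Equiv.refl (Fin (m + t)))))

/-- The class of an element of `HomSpace a (m + t)` in `ceRight t m`. -/
def ceMk (t m : ℕ) {a : ℕ} (ψ : HomSpace a (m + t)) : (ceRight t m).obj (op ⟨a⟩) :=
  Submodule.Quotient.mk ψ

/-- As for a representable functor, the element `ψ` is the restriction of the identity along `ψ`;
hence `ceRight t m` is cyclic. -/
theorem ceRight_map_ceOne (t m : ℕ) {a : ℕ} (ψ : CatLie.mk a ⟶ CatLie.mk (m + t)) :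
    (ceRight t m).map ψ.op (ceOne t m) = ceMk t m ψ :=
  congrArg Submodule.Quotient.mk (Category.comp_id ψ)

/-- Cyclicity and balancing together: everything can be pushed into the single summand `a = m + t`,
with the generator on the left. All later computations pass through this normal form. -/
theorem tensorMk_ceMk (t m : ℕ) (M : CatLie ⥤ ModuleCat ℚ) {a : ℕ}
    (ψ : CatLie.mk a ⟶ CatLie.mk (m + t)) (x : M.obj ⟨a⟩) :
    tensorMk (ceRight t m) M a (ceMk t m ψ) x =
      tensorMk (ceRight t m) M (m + t) (ceOne t m) (M.map ψ x) := by
  rw [← ceRight_map_ceOne, tensorMk_map]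

/-- The class in `ceRight t m ⊗_CatLie ℚ𝔖_n` of a bijection. -/
def permClass {n t m : ℕ} (e : Fin n ≃ Fin (m + t)) : TensorCarrier (ceRight t m) (regular n) :=
  tensorMk (ceRight t m) (regular n) (m + t) (ceOne t m) (Finsupp.single e 1)

/-- In normal form only the right factor varies, and at `m + t` the module `regular n` has the
bijections as a basis. So a linear map is determined by its values on them. -/
theorem tensor_ceRight_ext {n t m : ℕ} {N : Type} [AddCommGroup N] [Module ℚ N]
    {f g : TensorCarrier (ceRight t m) (regular n) →ₗ[ℚ] N}
    (h : ∀ e : Fin n ≃ Fin (m + t), f (permClass e) = g (permClass e)) : f = g := by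
  refine tensor_ext fun a r x => ?_
  obtain ⟨ψ, rfl⟩ := Submodule.Quotient.mk_surjective _ r
  have key := tensorMk_ceMk t m (regular n) ψ x
  refine (congrArg f key).trans (Eq.trans ?_ (congrArg g key).symm)
  generalize (regular n).map ψ x = y
  -- The value of `regular n` is a morphism space of `Free ℚ PermCat`, by definition the finitely
  -- supported functions on bijections.
  change (Fin n ≃ Fin (m + t)) →₀ ℚ at y
  induction y using Finsupp.induction_linear with
  | zero =>
    have := tensorMk_zero (ceRight t m) (regular n) (m + t) (ceOne t m)
    exact (congrArg f this).trans ((map_zero f).trans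
      ((map_zero g).symm.trans (congrArg g this).symm))
  | add x y hx hy =>
    have := tensorMk_add (ceRight t m) (regular n) (m + t) (ceOne t m) x y
    refine (congrArg f this).trans (Eq.trans ?_ (congrArg g this).symm)
    rw [map_add, map_add, hx, hy]
  | single e q =>
    have := tensorMk_smul (ceRight t m) (regular n) (m + t) (ceOne t m) q
      (Finsupp.single e (1 : ℚ))
    have he : Finsupp.single e q = q • Finsupp.single e (1 : ℚ) := by simp
    rw [he]
    refine (congrArg f this).trans (Eq.trans ?_ (congrArg g this).symm)
    rw [map_smul, map_smul]
    exact congrArg (q • ·) (h e)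

/-! ### Vanishing of the differential -/

/-- Each summand has a bracket on its output `i`, so the augmentation kills it separately; no
cancellation between terms is used. -/
theorem augHom_ceDiff (n t : ℕ) : augHom _ _ (ceDiff n t) = 0 := by
  simp only [ceDiff, map_sum, map_smul]
  refine Finset.sum_eq_zero fun j _ => ?_
  rw [Finset.sum_eq_zero fun i _ => ?_, smul_zero]
  split_ifs
  · rw [augHom_word]
    exact Forest.aug_eq_zero _ i (FreeMagma.of ((Fin.natAdd n j).succAbove i))
      (FreeMagma.of (Fin.natAdd n j)) (by simp [Forest.bracket])
  · rw [map_zero]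

/-- On the generator the differential yields the class of `ceDiff m t`. Balancing turns this into
the action of `ceDiff m t` on `ℚ𝔖_n`, which is zero because that action factors through the
augmentation. -/
theorem tensorMap_ceD (n t m : ℕ) :
    tensorMap ((ceD t).app ⟨m⟩) (𝟙 (regular n)) = 0 := by
  refine tensor_ceRight_ext fun e => ?_
  refine (tensorMap_mk _ _ _ _ _).trans ?_
  change tensorMk (ceRight t m) (regular n) (m + (t + 1)) (ceMk t m (compHom (m + t + 1)
    (m + t + 1) (m + t) (ceDiff m t) (word (Forest.perm (Equiv.refl _)))))
    (Finsupp.single e 1) = 0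
  have h : compHom (m + t + 1) (m + t + 1) (m + t) (ceDiff m t)
      (word (Forest.perm (Equiv.refl _))) = ceDiff m t :=
    Category.id_comp (X := CatLie.mk (m + t + 1)) (Y := CatLie.mk (m + t)) (ceDiff m t)
  rw [h]
  refine (tensorMk_ceMk t m (regular n) (a := m + (t + 1)) (ceDiff m t) _).trans ?_
  refine (congrArg (tensorMk (ceRight t m) (regular n) (m + t) (ceOne t m)) ?_).trans
    (tensorMk_zero (ceRight t m) (regular n) (m + t) (ceOne t m))
  -- Unfolds the module structure of `regular n`: a morphism acts by composing with its augmentation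
  -- in `ℚΣ`.
  change compPerm n (m + t + 1) (m + t) (Finsupp.single e 1) (augHom _ _ (ceDiff m t)) = 0
  rw [augHom_ceDiff, map_zero]

theorem ceTensor_d (n i j : ℕ) : (ceTensor (regular n)).d i j = 0 := by
  by_cases hij : j + 1 = i
  · subst hij
    have h : (ceTensor (regular n)).d (j + 1) j =
        ((Functor.whiskeringRight CatLie _ _).obj (tensorWith (regular n))).map (ceD j) :=
      congrArg ((Functor.whiskeringRight CatLie _ _).obj (tensorWith (regular n))).map
        (ChainComplex.of_d ceTerm ceD j)
    rw [h]
    ext m : 2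
    exact ModuleCat.hom_ext (tensorMap_ceD n j m.n)
  · exact (ceTensor (regular n)).shape i j hij

/-- The term of degree `t` of `CE ⊗_CatLie ℚ𝔖_n`. -/
def ceHomologyIso (n t : ℕ) :
    ceHomology n t ≅ ceTerm t ⋙ tensorWith (regular n) :=
  homologyIsoOfZero (ceTensor (regular n)) (ceTensor_d n) t

theorem ceHomologyRight_iso (n t : ℕ) (τ : Equiv.Perm (Fin n)) :
    ceHomologyRight n t τ ≫ (ceHomologyIso n t).hom =
      (ceHomologyIso n t).hom ≫
        Functor.whiskerLeft (ceTerm t) (tensorWithMap (regularRight n τ)) :=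
  homologyIsoOfZero_naturality (ceTensorMap (regularRight n τ)) (ceTensor_d n) (ceTensor_d n) t

/-! ### The left action factors through the augmentation -/

/-- The left action sends the generator to the class of `f ⊞ t`, which balancing then moves onto the
bijection. Hence `f` enters only through the augmentation of `f ⊞ t`. -/
theorem tensorMap_ceTerm_map {n t : ℕ} {a b : CatLie} (f : a ⟶ b) (e : Fin n ≃ Fin (a.n + t)) :
    tensorMap ((ceTerm t).map f) (𝟙 (regular n)) (permClass e) =
      tensorMk (ceRight t b.n) (regular n) (b.n + t) (ceOne t b.n)
        (compPerm n (a.n + t) (b.n + t) (Finsupp.single e 1)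
          (augHom _ _ (boxHom t a.n b.n f))) := by
  refine (tensorMap_mk _ _ _ _ _).trans ?_
  have h : compHom (a.n + t) (a.n + t) (b.n + t) (boxHom t a.n b.n f)
      (word (Forest.perm (Equiv.refl _))) = boxHom t a.n b.n f :=
    Category.id_comp (X := CatLie.mk (a.n + t)) (Y := CatLie.mk (b.n + t)) _
  change tensorMk (ceRight t b.n) (regular n) (a.n + t) (ceMk t b.n (compHom (a.n + t) (a.n + t)
    (b.n + t) (boxHom t a.n b.n f) (word (Forest.perm (Equiv.refl _))))) (Finsupp.single e 1) = _
  rw [h]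
  exact tensorMk_ceMk t b.n (regular n) (a := a.n + t) (boxHom t a.n b.n f) _

/-- The unit of the operad is a section of the augmentation, as one sees by expanding `x` in the
basis of bijections. -/
theorem augHom_unit {a b : ℕ} (x : (Fin a ≃ Fin b) →₀ ℚ) :
    augHom a b (unit.map (X := Free.of ℚ ⟨a⟩) (Y := Free.of ℚ ⟨b⟩) x) = x := by
  change augHom a b (x.sum fun σ r => r • word (Forest.perm σ)) = x
  rw [Finsupp.sum, map_sum]
  simp only [map_smul, augHom_word, Forest.aug_perm, Finsupp.smul_single, smul_eq_mul, mul_one]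
  exact Finsupp.sum_single x

/-- Juxtaposition of a bijection with an identity. -/
def boxPerm (t : ℕ) {a b : ℕ} (σ : Fin a ≃ Fin b) : Fin (a + t) ≃ Fin (b + t) :=
  finSumFinEquiv.symm.trans ((Equiv.sumCongr σ (Equiv.refl (Fin t))).trans finSumFinEquiv)

theorem Forest.box_perm (t : ℕ) {a b : ℕ} (σ : Fin a ≃ Fin b) :
    (Forest.perm σ).box t = Forest.perm (boxPerm t σ) := by
  refine Forest.ext (funext fun i => ?_)
  induction i using Fin.addCases <;> simp [Forest.box, Forest.perm, boxPerm]

/-- Adding trivial trees neither creates nor destroys brackets: a bijection becomes a bijection, and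
a bracketed forest stays bracketed. -/
theorem augHom_boxHom (t : ℕ) {a b : ℕ} (f : HomSpace a b) :
    augHom _ _ (boxHom t a b f) = Finsupp.lmapDomain ℚ ℚ (boxPerm t) (augHom a b f) := by
  induction f using homSpace_induction with
  | h0 => simp
  | hadd x y hx hy => simp only [map_add, hx, hy]
  | hw r F =>
    simp only [map_smul, boxHom_word, augHom_word]
    congr 1
    by_cases hF : ∀ i, ∃ j, F.tree i = FreeMagma.of j
    · obtain ⟨σ, rfl⟩ := F.exists_perm hF
      rw [Forest.box_perm, Forest.aug_perm, Forest.aug_perm, Finsupp.lmapDomain_apply,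
        Finsupp.mapDomain_single]
    · push Not at hF
      obtain ⟨k, hk⟩ := hF
      cases hT : F.tree k with
      | of x => exact absurd hT (hk x)
      | mul S T =>
        rw [Forest.aug_eq_zero F k S T hT, map_zero]
        -- The bracket of tree `k` survives, with relabelled leaves, at the output `Fin.castAdd t
        -- k`.
        refine Forest.aug_eq_zero _ (Fin.castAdd t k) (FreeMagma.map (Fin.castAdd t) S)
          (FreeMagma.map (Fin.castAdd t) T) ?_
        simp only [Forest.box, Fin.addCases_left, hT]
        rfl

/-- This is the form of the first assertion that can be checked on generators. After passing to the
terms, each side depends only on the augmentation of the morphism boxed with `t`. -/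
theorem ceHomology_map_eq (n t : ℕ) {a b : CatLie} (f g : a ⟶ b) (h : aug.map f = aug.map g) :
    (ceHomology n t).map f = (ceHomology n t).map g := by
  rw [← cancel_mono ((ceHomologyIso n t).hom.app b), NatTrans.naturality, NatTrans.naturality]
  refine congrArg ((ceHomologyIso n t).hom.app a ≫ ·)
    (ModuleCat.hom_ext (tensor_ceRight_ext fun e => ?_))
  refine (tensorMap_ceTerm_map f e).trans (Eq.trans ?_ (tensorMap_ceTerm_map g e).symm)
  have h' : augHom a.n b.n f = augHom a.n b.n g := h
  rw [augHom_boxHom, augHom_boxHom, h']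

theorem isZero_ceHomology (n t m : ℕ) (h : m + t ≠ n) :
    Limits.IsZero ((ceHomology n t).obj ⟨m⟩) := by
  refine Limits.IsZero.of_iso ?_ ((ceHomologyIso n t).app ⟨m⟩)
  rw [Limits.IsZero.iff_id_eq_zero]
  -- The identity and zero need only agree on generators, and there are none: a bijection `e` would
  -- give `n = m + t` by counting.
  refine ModuleCat.hom_ext (tensor_ceRight_ext fun e => absurd ?_ h)
  simpa using (Fintype.card_congr e).symm

/-! ### Presentation of the terms by bijections and signs -/

theorem tensorMk_smul_left (R : CatLieᵒᵖ ⥤ ModuleCat ℚ) (M : CatLie ⥤ ModuleCat ℚ) (a : ℕ)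
    (r : R.obj (op ⟨a⟩)) (q : ℚ) (x : M.obj ⟨a⟩) :
    tensorMk R M a (q • r) x = q • tensorMk R M a r x := by
  rw [tensorMk, ← TensorProduct.smul_tmul', map_smul, Submodule.Quotient.mk_smul, tensorMk]

/-- The sign relation taken at `ψ` the identity. -/
theorem ceMk_permWord {m t : ℕ} (σ : Equiv.Perm (Fin t)) :
    ceMk t m (permWord m σ) = ((Equiv.Perm.sign σ : ℤ) : ℚ) • ceOne t m := by
  refine (Submodule.Quotient.eq _).2
    (Submodule.subset_span ⟨σ, word (Forest.perm (Equiv.refl _)), ?_⟩)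
  exact congrArg (· - _) (Category.id_comp (X := CatLie.mk (m + t)) (Y := CatLie.mk (m + t))
    (permWord m σ)).symm

theorem tensorMk_perm {n m t b : ℕ} (e : Fin n ≃ Fin (m + t)) (σ : Fin (m + t) ≃ Fin (b + t)) :
    tensorMk (ceRight t b) (regular n) (m + t) (ceMk t b (word (Forest.perm σ)))
      (Finsupp.single e 1) = permClass (e.trans σ) := by
  refine (tensorMk_ceMk t b (regular n) (a := m + t) (word (Forest.perm σ)) _).trans
    (congrArg (tensorMk (ceRight t b) (regular n) (b + t) (ceOne t b)) ?_)
  change compPerm n (m + t) (b + t) (Finsupp.single e 1) (augHom _ _ (word (Forest.perm σ))) = _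
  rw [augHom_word, Forest.aug_perm, compPerm_single]
  rfl

/-- Balancing in reverse: the permutation of the last letters returns to the left factor, where it
is a sign. -/
theorem permClass_trans_lastPerm {n m t : ℕ} (e : Fin n ≃ Fin (m + t)) (σ : Equiv.Perm (Fin t)) :
    permClass (e.trans (lastPerm m σ)) = ((Equiv.Perm.sign σ : ℤ) : ℚ) • permClass e := by
  rw [← tensorMk_perm]
  change tensorMk (ceRight t m) (regular n) (m + t) (ceMk t m (permWord m σ)) _ = _
  rw [ceMk_permWord]
  exact tensorMk_smul_left _ _ _ _ _ _

theorem compPerm_assoc {a b c d : ℕ} (x : (Fin a ≃ Fin b) →₀ ℚ) (y : (Fin b ≃ Fin c) →₀ ℚ)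
    (z : (Fin c ≃ Fin d) →₀ ℚ) :
    compPerm a c d (compPerm a b c x y) z = compPerm a b d x (compPerm b c d y z) :=
  Category.assoc (obj := Free ℚ PermCat) (W := Free.of ℚ ⟨a⟩) (X := Free.of ℚ ⟨b⟩)
    (Y := Free.of ℚ ⟨c⟩) (Z := Free.of ℚ ⟨d⟩) x y z

/-- Sign equivariance of `P` on bijections, extended linearly to `ℚΣ`; it makes the map of
`tensorDesc` vanish on the sign relations. -/
theorem linearCombination_lastPerm {n m t : ℕ} {N : Type} [AddCommGroup N] [Module ℚ N]
    (P : (Fin n ≃ Fin (m + t)) → N) (σ : Equiv.Perm (Fin t))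
    (hP : ∀ e, P (e.trans (lastPerm m σ)) = ((Equiv.Perm.sign σ : ℤ) : ℚ) • P e)
    (x : (Fin n ≃ Fin (m + t)) →₀ ℚ) :
    Finsupp.linearCombination ℚ P
        (compPerm n (m + t) (m + t) x (Finsupp.single (lastPerm m σ) 1)) =
      ((Equiv.Perm.sign σ : ℤ) : ℚ) • Finsupp.linearCombination ℚ P x := by
  induction x using Finsupp.induction_linear with
  | zero => simp
  | add x y hx hy => simp only [map_add, LinearMap.add_apply, smul_add, hx, hy]
  | single e q =>
    have hq : Finsupp.single e q = q • Finsupp.single e (1 : ℚ) := by simp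
    rw [hq, map_smul, LinearMap.smul_apply, compPerm_single, map_smul, map_smul,
      Finsupp.linearCombination_single, Finsupp.linearCombination_single, one_smul, one_smul, hP,
      smul_comm]

/-- Linear maps out of `ceRight t m ⊗_CatLie ℚ𝔖_n` are given by functions on bijections
compatible with the signs. -/
def tensorDesc {n m t : ℕ} {N : Type} [AddCommGroup N] [Module ℚ N]
    (P : (Fin n ≃ Fin (m + t)) → N)
    (hP : ∀ e (σ : Equiv.Perm (Fin t)),
      P (e.trans (lastPerm m σ)) = ((Equiv.Perm.sign σ : ℤ) : ℚ) • P e) :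
    TensorCarrier (ceRight t m) (regular n) →ₗ[ℚ] N :=
  (tensorRel (ceRight t m) (regular n)).liftQ
    -- A tensor `ψ ⊗ x` goes to the linear extension of `P` evaluated at `x` followed by the
    -- augmentation of `ψ`. This has to be defined on every summand `a`, then shown to respect first
    -- the sign relations and then balancing.
    (DirectSum.toModule ℚ ℕ N fun a => TensorProduct.lift
      ((signRel a m t).liftQ
        (((compPerm n a (m + t)).flip.compr₂ (Finsupp.linearCombination ℚ P)) ∘ₗ augHom a (m + t))
        (by
          refine Submodule.span_le.2 ?_
          rintro _ ⟨σ, ψ, rfl⟩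
          rw [SetLike.mem_coe, LinearMap.mem_ker]
          refine LinearMap.ext fun x => ?_
          rw [map_sub, map_smul]
          refine sub_eq_zero.2 ?_
          change Finsupp.linearCombination ℚ P (compPerm n a (m + t) x
            (augHom _ _ (compHom a (m + t) (m + t) (permWord m σ) ψ))) =
            ((Equiv.Perm.sign σ : ℤ) : ℚ) •
              Finsupp.linearCombination ℚ P (compPerm n a (m + t) x (augHom _ _ ψ))
          -- The augmentation is multiplicative and fixes permutations, so the relation reduces to
          -- composing with `lastPerm m σ` at the end.
          rw [augHom_comp, permWord, augHom_word, Forest.aug_perm]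
          exact (congrArg _ (compPerm_assoc x (augHom a (m + t) ψ) _).symm).trans
            (linearCombination_lastPerm P σ (hP · σ) _))))
    (by
      refine Submodule.span_le.2 ?_
      rintro _ ⟨a, b, f, r, x, rfl⟩
      obtain ⟨ψ, rfl⟩ := Submodule.Quotient.mk_surjective _ r
      rw [SetLike.mem_coe, LinearMap.mem_ker, map_sub, sub_eq_zero, DirectSum.toModule_lof,
        DirectSum.toModule_lof]
      change Finsupp.linearCombination ℚ P (compPerm n a (m + t) x
        (augHom a (m + t) (compHom a b (m + t) ψ f))) =
        Finsupp.linearCombination ℚ P (compPerm n b (m + t) (compPerm n a b x (augHom a b f))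
          (augHom b (m + t) ψ))
      -- Both sides evaluate `P` on the triple composite of `x` with the augmentations of `f` and
      -- `ψ`, so balancing is associativity in `ℚΣ`.
      rw [augHom_comp]
      exact congrArg _ (compPerm_assoc x (augHom a b f) (augHom b (m + t) ψ)).symm)

theorem tensorDesc_permClass {n m t : ℕ} {N : Type} [AddCommGroup N] [Module ℚ N]
    (P : (Fin n ≃ Fin (m + t)) → N)
    (hP : ∀ e (σ : Equiv.Perm (Fin t)),
      P (e.trans (lastPerm m σ)) = ((Equiv.Perm.sign σ : ℤ) : ℚ) • P e)
    (e : Fin n ≃ Fin (m + t)) : tensorDesc P hP (permClass e) = P e := by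
  refine (Submodule.liftQ_apply _ _ _).trans ((DirectSum.toModule_lof ℚ _ _).trans ?_)
  change Finsupp.linearCombination ℚ P (compPerm n (m + t) (m + t) (Finsupp.single e 1)
    (augHom _ _ (word (Forest.perm (Equiv.refl _))))) = P e
  rw [augHom_word, Forest.aug_perm, compPerm_single, Finsupp.linearCombination_single, one_smul]
  rfl

/-! ### Bijections onto `Fin (m + t)` as a subset with two bijections -/

section Glue

variable {X : Type} {m t : ℕ}

open Classical in
/-- The bijection `X ≃ Fin (m + t)` glued from bijections of a subset and of its complement. -/
def glue (A : Set X) (e : A ≃ Fin m) (f : (Aᶜ : Set X) ≃ Fin t) : X ≃ Fin (m + t) :=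
  (Equiv.Set.sumCompl A).symm.trans ((Equiv.sumCongr e f).trans finSumFinEquiv)

theorem glue_of_mem (A : Set X) (e : A ≃ Fin m) (f : (Aᶜ : Set X) ≃ Fin t) {x : X} (hx : x ∈ A) :
    glue A e f x = Fin.castAdd t (e ⟨x, hx⟩) := by
  classical
  simp [glue, Equiv.Set.sumCompl_symm_apply_of_mem hx]

theorem glue_of_notMem (A : Set X) (e : A ≃ Fin m) (f : (Aᶜ : Set X) ≃ Fin t) {x : X}
    (hx : x ∉ A) : glue A e f x = Fin.natAdd m (f ⟨x, hx⟩) := by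
  classical
  simp [glue, Equiv.Set.sumCompl_symm_apply_of_notMem hx]

/-- Recovers the subset from the glued bijection, as the preimage of the first `m` letters. -/
theorem glue_lt_iff (A : Set X) (e : A ≃ Fin m) (f : (Aᶜ : Set X) ≃ Fin t) (x : X) :
    (glue A e f x : ℕ) < m ↔ x ∈ A := by
  by_cases hx : x ∈ A
  · simp [glue_of_mem A e f hx, hx]
  · simp [glue_of_notMem A e f hx, hx]

theorem glue_ext (A : Set X) (e : A ≃ Fin m) (f : (Aᶜ : Set X) ≃ Fin t) (g : X ≃ Fin (m + t))
    (h₁ : ∀ x : A, g x = Fin.castAdd t (e x)) (h₂ : ∀ x : (Aᶜ : Set X), g x = Fin.natAdd m (f x)) :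
    g = glue A e f := by
  refine Equiv.ext fun x => ?_
  by_cases hx : x ∈ A
  · rw [glue_of_mem A e f hx, ← h₁]
  · rw [glue_of_notMem A e f hx, ← h₂]

theorem exists_glue (g : X ≃ Fin (m + t)) :
    ∃ (A : Set X) (e : A ≃ Fin m) (f : (Aᶜ : Set X) ≃ Fin t), g = glue A e f := by
  -- The only possible choice, by `glue_lt_iff`. On the complement `g x ≥ m`, so the natural-number
  -- subtraction `g x - m` used below does not truncate.
  let A : Set X := {x | (g x : ℕ) < m}
  have hA : ∀ x : (Aᶜ : Set X), ¬ (g x : ℕ) < m := fun x => x.2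
  refine ⟨A, ⟨fun x => ⟨g x, x.2⟩, fun i => ⟨g.symm (Fin.castAdd t i), by simp [A]⟩,
      fun x => Subtype.ext ?_, fun i => ?_⟩,
    ⟨fun x => ⟨g x - m, by have := (g x).2; have := hA x; omega⟩,
      fun i => ⟨g.symm (Fin.natAdd m i), by simp [A]⟩, fun x => Subtype.ext ?_, fun i => ?_⟩,
    glue_ext _ _ _ _ (fun x => Fin.ext rfl) fun x => Fin.ext ?_⟩
  · exact (Equiv.symm_apply_eq _).2 (Fin.ext rfl)
  · simp
  · refine (Equiv.symm_apply_eq _).2 (Fin.ext ?_)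
    have := hA x
    simp
    omega
  · simp
  · have := hA x
    simp
    omega

/-- The subsets must be identified before the bijections can be compared, since these have different
types until then; hence the transports along `hAB`. -/
theorem glue_inj {A B : Set X} {e : A ≃ Fin m} {f : (Aᶜ : Set X) ≃ Fin t} {e' : B ≃ Fin m}
    {f' : (Bᶜ : Set X) ≃ Fin t} (h : glue A e f = glue B e' f') :
    ∃ hAB : A = B, hAB ▸ e = e' ∧ hAB ▸ f = f' := by
  have hAB : A = B := Set.ext fun x => by rw [← glue_lt_iff A e f, h, glue_lt_iff]
  subst hAB
  refine ⟨rfl, Equiv.ext fun x => ?_, Equiv.ext fun x => ?_⟩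
  · have := Equiv.congr_fun h x
    rw [glue_of_mem A _ _ x.2, glue_of_mem A _ _ x.2] at this
    exact Fin.castAdd_injective _ _ this
  · have := Equiv.congr_fun h x
    rw [glue_of_notMem A _ _ x.2, glue_of_notMem A _ _ x.2] at this
    exact Fin.natAdd_injective _ _ this

/-- This rule governs the sign relations; the next two govern the left action of bijections of the
first `m` letters and the right action of `𝔖_n`. -/
theorem glue_trans_lastPerm (A : Set X) (e : A ≃ Fin m) (f : (Aᶜ : Set X) ≃ Fin t)
    (σ : Equiv.Perm (Fin t)) :
    (glue A e f).trans (lastPerm m σ) = glue A e (f.trans σ) := by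
  refine glue_ext _ _ _ _ (fun x => ?_) fun x => ?_
  · rw [Equiv.trans_apply, glue_of_mem A e f x.2, lastPerm_castAdd]
  · rw [Equiv.trans_apply, glue_of_notMem A e f x.2, lastPerm_natAdd]
    rfl

theorem glue_trans_boxPerm {m' : ℕ} (A : Set X) (e : A ≃ Fin m) (f : (Aᶜ : Set X) ≃ Fin t)
    (σ : Fin m ≃ Fin m') : (glue A e f).trans (boxPerm t σ) = glue A (e.trans σ) f := by
  refine glue_ext _ _ _ _ (fun x => ?_) fun x => ?_
  · rw [Equiv.trans_apply, glue_of_mem A e f x.2]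
    simp [boxPerm]
  · rw [Equiv.trans_apply, glue_of_notMem A e f x.2]
    simp [boxPerm]

/-- Precomposition changes the subset to its preimage, exactly as `convMap` moves summands. -/
theorem trans_glue {Y : Type} (τ : Y ≃ X) (A : Set X) (e : A ≃ Fin m)
    (f : (Aᶜ : Set X) ≃ Fin t) :
    τ.trans (glue A e f) =
      glue (τ ⁻¹' A) ((τ.subtypeEquiv (p := (· ∈ τ ⁻¹' A)) (q := (· ∈ A)) fun _ => Iff.rfl).trans e)
        ((τ.subtypeEquiv (p := (· ∈ (τ ⁻¹' A)ᶜ)) (q := (· ∈ Aᶜ)) fun _ => Iff.rfl).trans f) := by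
  refine glue_ext _ _ _ _ (fun x => ?_) fun x => ?_
  · rw [Equiv.trans_apply, glue_of_mem A e f x.2]
    rfl
  · rw [Equiv.trans_apply, glue_of_notMem A e f x.2]
    rfl

end Glue

/-! ### Generators and relations of `ℚ𝔖_m ⊙ sgn_t` -/

/-- The value on `S` of `ℚ𝔖_m ⊙ sgn_t`. -/
abbrev RegularConv (t m : ℕ) (S : FinBij) : Type :=
  ConvCarrier (regularBimodule.obj ⟨Fin m⟩) (sgn t) S

/-- The element of `ℚ𝔖_m ⊙ sgn_t` given by a subset and bijections of it and of its complement. -/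
def convClass {t m : ℕ} {S : FinBij} (A : Set S.carrier) (e : A ≃ Fin m)
    (f : (Aᶜ : Set S.carrier) ≃ Fin t) : RegularConv t m S :=
  convOf (regularBimodule.obj ⟨Fin m⟩) (sgn t) S A
    (ModuleCat.freeMk (R := ℚ) (X := (S.sub A ⟶ (⟨Fin m⟩ : FinBij))) e ⊗ₜ
      (Submodule.Quotient.mk (Finsupp.single f 1) :
        (((Aᶜ : Set S.carrier) ≃ Fin t) →₀ ℚ) ⧸ sgnRel t (Aᶜ : Set S.carrier)))

theorem sgn_mk_trans {t : ℕ} {T : Type} (f : T ≃ Fin t) (σ : Equiv.Perm (Fin t)) :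
    (Submodule.Quotient.mk (Finsupp.single (f.trans σ) 1) : ((T ≃ Fin t) →₀ ℚ) ⧸ sgnRel t T) =
      ((Equiv.Perm.sign σ : ℤ) : ℚ) • Submodule.Quotient.mk (Finsupp.single f 1) := by
  rw [← Submodule.Quotient.mk_smul, Submodule.Quotient.eq, Finsupp.smul_single, smul_eq_mul,
    mul_one]
  exact Submodule.subset_span ⟨σ, f, rfl⟩

theorem convClass_trans {t m : ℕ} {S : FinBij} (A : Set S.carrier) (e : A ≃ Fin m)
    (f : (Aᶜ : Set S.carrier) ≃ Fin t) (σ : Equiv.Perm (Fin t)) :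
    convClass A e (f.trans σ) = ((Equiv.Perm.sign σ : ℤ) : ℚ) • convClass A e f := by
  rw [convClass, sgn_mk_trans]
  exact (congrArg (convOf (regularBimodule.obj ⟨Fin m⟩) (sgn t) S A)
    (TensorProduct.tmul_smul _ _ _)).trans (map_smul _ _ _)

/-- Each summand is a free module tensored with a quotient of a free module, so basis elements of
the two factors generate it. -/
theorem regularConv_ext {t m : ℕ} {S : FinBij} {N : Type} [AddCommGroup N] [Module ℚ N]
    {F G : RegularConv t m S →ₗ[ℚ] N}
    (h : ∀ (A : Set S.carrier) e f, F (convClass A e f) = G (convClass A e f)) : F = G := by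
  classical
  refine DirectSum.linearMap_ext _ fun A => TensorProduct.ext ?_
  have key : ∀ e : S.sub A ⟶ (⟨Fin m⟩ : FinBij),
      (TensorProduct.mk ℚ _ _).compr₂ (F ∘ₗ convOf (regularBimodule.obj ⟨Fin m⟩) (sgn t) S A)
        (ModuleCat.freeMk (R := ℚ) e) =
      (TensorProduct.mk ℚ _ _).compr₂ (G ∘ₗ convOf (regularBimodule.obj ⟨Fin m⟩) (sgn t) S A)
        (ModuleCat.freeMk (R := ℚ) e) := fun e =>
    Submodule.linearMap_qext _ (Finsupp.lhom_ext' fun f => LinearMap.ext_ring (h A e f))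
  -- Currying makes each map a linear map out of the free module on bijections of `A`, where
  -- extensionality for `ModuleCat.free` applies.
  exact congrArg ModuleCat.Hom.hom (ModuleCat.free_hom_ext
    (f := ModuleCat.ofHom ((TensorProduct.mk ℚ _ _).compr₂
      (F ∘ₗ convOf (regularBimodule.obj ⟨Fin m⟩) (sgn t) S A)))
    (g := ModuleCat.ofHom ((TensorProduct.mk ℚ _ _).compr₂
      (G ∘ₗ convOf (regularBimodule.obj ⟨Fin m⟩) (sgn t) S A))) key)

open Classical in
/-- Linear maps out of `ℚ𝔖_m ⊙ sgn_t` are given by functions compatible with the signs. -/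
def regularConvDesc {t m : ℕ} {S : FinBij} {N : Type} [AddCommGroup N] [Module ℚ N]
    (P : ∀ A : Set S.carrier, (A ≃ Fin m) → ((Aᶜ : Set S.carrier) ≃ Fin t) → N)
    (hP : ∀ A e f σ, P A e (f.trans σ) = ((Equiv.Perm.sign σ : ℤ) : ℚ) • P A e f) :
    RegularConv t m S →ₗ[ℚ] N :=
  DirectSum.toModule ℚ (Set S.carrier) N fun A => TensorProduct.lift
    (ModuleCat.freeDesc (R := ℚ) (X := (S.sub A ⟶ (⟨Fin m⟩ : FinBij)))
      (M := ModuleCat.of ℚ (((((Aᶜ : Set S.carrier) ≃ Fin t) →₀ ℚ) ⧸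
        sgnRel t (Aᶜ : Set S.carrier)) →ₗ[ℚ] N))
      (↾fun e => (sgnRel t (Aᶜ : Set S.carrier)).liftQ
        (Finsupp.linearCombination ℚ (P A e)) (by
          refine Submodule.span_le.2 ?_
          rintro _ ⟨σ, f, rfl⟩
          rw [SetLike.mem_coe, LinearMap.mem_ker, map_sub, Finsupp.linearCombination_single,
            Finsupp.linearCombination_single, one_smul]
          exact sub_eq_zero.2 (hP A e f σ)))).hom

theorem regularConvDesc_convClass {t m : ℕ} {S : FinBij} {N : Type} [AddCommGroup N] [Module ℚ N]
    (P : ∀ A : Set S.carrier, (A ≃ Fin m) → ((Aᶜ : Set S.carrier) ≃ Fin t) → N)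
    (hP : ∀ A e f σ, P A e (f.trans σ) = ((Equiv.Perm.sign σ : ℤ) : ℚ) • P A e f)
    (A : Set S.carrier) (e : A ≃ Fin m) (f : (Aᶜ : Set S.carrier) ≃ Fin t) :
    regularConvDesc P hP (convClass A e f) = P A e f := by
  rw [regularConvDesc, convClass, convOf, DirectSum.toModule_lof]
  refine (TensorProduct.lift.tmul _ _).trans ?_
  refine (congrArg (fun F : ((((Aᶜ : Set S.carrier) ≃ Fin t) →₀ ℚ) ⧸
    sgnRel t (Aᶜ : Set S.carrier)) →ₗ[ℚ] N => F (Submodule.Quotient.mk (Finsupp.single f 1)))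
    (ModuleCat.freeDesc_apply _ _)).trans ?_
  refine (Submodule.liftQ_apply _ _ _).trans ?_
  rw [Finsupp.linearCombination_single, one_smul]

/-- The element of `ℚ𝔖_m ⊙ sgn_t` given by a bijection with `Fin (m + t)`. -/
def splitClass {t m : ℕ} {S : FinBij} (g : S.carrier ≃ Fin (m + t)) : RegularConv t m S :=
  convClass _ (exists_glue g).choose_spec.choose (exists_glue g).choose_spec.choose_spec.choose

/-- The decomposition was selected by choice, but it is unique, so the choice is invisible. -/
theorem splitClass_glue {t m : ℕ} {S : FinBij} (A : Set S.carrier) (e : A ≃ Fin m)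
    (f : (Aᶜ : Set S.carrier) ≃ Fin t) :
    splitClass (S := S) (glue A e f) = convClass A e f := by
  obtain ⟨hA, he, hf⟩ := glue_inj (exists_glue (glue A e f)).choose_spec.choose_spec.choose_spec
  rw [splitClass]
  -- The chosen data become variables, the most dependent first, so that the transports vanish on
  -- substituting.
  generalize (exists_glue (glue A e f)).choose_spec.choose_spec.choose = f' at *
  generalize (exists_glue (glue A e f)).choose_spec.choose = e' at *
  generalize (exists_glue (glue A e f)).choose = A' at *
  subst hA he hf
  rfl

theorem splitClass_trans_lastPerm {t m : ℕ} {S : FinBij} (g : S.carrier ≃ Fin (m + t))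
    (σ : Equiv.Perm (Fin t)) : splitClass (S := S) (g.trans (lastPerm m σ)) =
      ((Equiv.Perm.sign σ : ℤ) : ℚ) • splitClass (S := S) g := by
  obtain ⟨A, e, f, rfl⟩ := exists_glue g
  rw [glue_trans_lastPerm, splitClass_glue, splitClass_glue, convClass_trans]

/-! ### The comparison isomorphism and its equivariance -/

/-- The vector space `ceRight t m ⊗_CatLie ℚ𝔖_n` is the value on `n` of `ℚ𝔖_m ⊙ sgn_t`. -/
def tensorEquivConv (n t m : ℕ) :
    TensorCarrier (ceRight t m) (regular n) ≃ₗ[ℚ] RegularConv t m ⟨Fin n⟩ :=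
  LinearEquiv.ofLinearMap
    -- Both maps come from universal properties and exchange `permClass (glue A e f)` with
    -- `convClass A e f`; both composites are identities because they fix generators.
    (tensorDesc (fun g => splitClass (S := ⟨Fin n⟩) g)
      (splitClass_trans_lastPerm (S := ⟨Fin n⟩)))
    (regularConvDesc (S := ⟨Fin n⟩) (fun A e f => permClass (glue A e f)) fun A e f σ => by
      rw [← glue_trans_lastPerm, permClass_trans_lastPerm])
    (regularConv_ext fun A e f => by
      rw [LinearMap.comp_apply, regularConvDesc_convClass, tensorDesc_permClass, splitClass_glue]
      rfl)
    (tensor_ceRight_ext fun g => by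
      obtain ⟨A, e, f, rfl⟩ := exists_glue g
      rw [LinearMap.comp_apply, tensorDesc_permClass, splitClass_glue (S := ⟨Fin n⟩),
        regularConvDesc_convClass]
      rfl)

theorem tensorEquivConv_permClass_glue {n t m : ℕ} (A : Set (Fin n)) (e : A ≃ Fin m)
    (f : (Aᶜ : Set (Fin n)) ≃ Fin t) : tensorEquivConv n t m (permClass (glue A e f)) =
      convClass (S := ⟨Fin n⟩) A e f :=
  (tensorDesc_permClass (fun g => splitClass (S := ⟨Fin n⟩) g)
    (splitClass_trans_lastPerm (S := ⟨Fin n⟩)) _).trans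
    (splitClass_glue (S := ⟨Fin n⟩) A e f)

theorem tensorMap_ceTerm_map_perm {n t : ℕ} {a b : PermCat} (σ : a ⟶ b)
    (g : Fin n ≃ Fin (a.n + t)) :
    tensorMap ((ceTerm t).map (permFunctor.map σ)) (𝟙 (regular n)) (permClass g) =
      permClass (g.trans (boxPerm t σ)) := by
  refine (tensorMap_ceTerm_map (a := permFunctor.obj a) (b := permFunctor.obj b)
    (permFunctor.map σ) g).trans ?_
  have h : boxHom t a.n b.n (permFunctor.map σ) = word (Forest.perm (boxPerm t σ)) :=
    (boxHom_word t (Forest.perm σ)).trans (congrArg word (Forest.box_perm t σ))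
  refine congrArg (tensorMk (ceRight t b.n) (regular n) (b.n + t) (ceOne t b.n)) ?_
  refine (congrArg (fun x => compPerm n (a.n + t) (b.n + t) (Finsupp.single g 1)
    (augHom _ _ x)) h).trans ?_
  rw [augHom_word, Forest.aug_perm, compPerm_single]
  rfl

/-- The right regular action precomposes with `τ` and leaves the generator of the left factor
unchanged. -/
theorem tensorMap_regularRight {n t m : ℕ} (τ : Equiv.Perm (Fin n)) (g : Fin n ≃ Fin (m + t)) :
    tensorMap (𝟙 (ceRight t m)) (regularRight n τ) (permClass g) = permClass (τ.trans g) := by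
  refine (tensorMap_mk _ _ _ _ _).trans ?_
  refine congrArg (tensorMk (ceRight t m) (regular n) (m + t) (ceOne t m)) ?_
  exact compPerm_single τ g

theorem convHom_convClass {t : ℕ} {a b : PermCat} (σ : a ⟶ b) {S : FinBij} (A : Set S.carrier)
    (e : A ≃ Fin a.n) (f : (Aᶜ : Set S.carrier) ≃ Fin t) :
    convHom (regularBimodule.map (skeleton.map σ)) (sgn t) S (convClass A e f) =
      convClass A (e.trans σ) f := by
  refine (convHom_of _ _ _ _ _ _).trans ?_
  refine congrArg (fun x => convOf (regularBimodule.obj ⟨Fin b.n⟩) (sgn t) S A (x ⊗ₜ _)) ?_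
  exact ModuleCat.free_map_apply _ _

theorem convMap_convClass {t m : ℕ} {S T : FinBij} (τ : S ⟶ T) (A : Set T.carrier)
    (e : A ≃ Fin m) (f : (Aᶜ : Set T.carrier) ≃ Fin t) :
    convMap (regularBimodule.obj ⟨Fin m⟩) (sgn t) τ (convClass A e f) =
      convClass (FinBij.equiv τ ⁻¹' A)
        (((FinBij.equiv τ).subtypeEquiv (p := (· ∈ FinBij.equiv τ ⁻¹' A)) (q := (· ∈ A))
          fun _ => Iff.rfl).trans e)
        (((FinBij.equiv τ).subtypeEquiv (p := (· ∈ (FinBij.equiv τ ⁻¹' A)ᶜ)) (q := (· ∈ Aᶜ))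
          fun _ => Iff.rfl).trans f) := by
  refine (convMap_of _ _ _ _ _ _).trans ?_
  refine congrArg (convOf (regularBimodule.obj ⟨Fin m⟩) (sgn t) S (FinBij.equiv τ ⁻¹' A))
    (congrArg₂ (· ⊗ₜ[ℚ] ·) ?_ ?_)
  · exact ModuleCat.free_map_apply _ _
  · exact sgnMap_mk t _ f

/-- On the generator indexed by `A`, `e`, `f`, both sides replace `e` by `e.trans σ`: boxing with
`t` touches only the first `m` letters. -/
theorem tensorEquivConv_natural {n t : ℕ} {a b : PermCat} (σ : a ⟶ b)
    (x : TensorCarrier (ceRight t a.n) (regular n)) :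
    tensorEquivConv n t b.n (tensorMap ((ceTerm t).map (permFunctor.map σ)) (𝟙 (regular n)) x) =
      convHom (regularBimodule.map (skeleton.map σ)) (sgn t) ⟨Fin n⟩
        (tensorEquivConv n t a.n x) := by
  -- Stated as an equality of linear maps so that it can be tested on bijections instead of on an
  -- arbitrary `x`.
  refine LinearMap.congr_fun (f := (tensorEquivConv n t b.n).toLinearMap ∘ₗ
      tensorMap ((ceTerm t).map (permFunctor.map σ)) (𝟙 (regular n)))
    (g := convHom (regularBimodule.map (skeleton.map σ)) (sgn t) ⟨Fin n⟩ ∘ₗ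
      (tensorEquivConv n t a.n).toLinearMap)
    (tensor_ceRight_ext (m := a.n) (N := RegularConv t b.n ⟨Fin n⟩) fun g => ?_) x
  obtain ⟨A, e, f, rfl⟩ := exists_glue g
  refine (congrArg (tensorEquivConv n t b.n) (tensorMap_ceTerm_map_perm σ _)).trans ?_
  refine Eq.trans ?_ (congrArg (convHom (regularBimodule.map (skeleton.map σ)) (sgn t) ⟨Fin n⟩)
    (tensorEquivConv_permClass_glue A e f)).symm
  refine Eq.trans ?_ (convHom_convClass (S := ⟨Fin n⟩) σ A e f).symm
  rw [glue_trans_boxPerm, tensorEquivConv_permClass_glue]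

/-- On generators both sides pull the subset and its two bijections back along `τ`. -/
theorem tensorEquivConv_right {n t m : ℕ} (τ : Equiv.Perm (Fin n))
    (x : TensorCarrier (ceRight t m) (regular n)) :
    tensorEquivConv n t m (tensorMap (𝟙 (ceRight t m)) (regularRight n τ) x) =
      convMap (regularBimodule.obj ⟨Fin m⟩) (sgn t) (S := ⟨Fin n⟩) (T := ⟨Fin n⟩) τ
        (tensorEquivConv n t m x) := by
  refine LinearMap.congr_fun (f := (tensorEquivConv n t m).toLinearMap ∘ₗ
      tensorMap (𝟙 (ceRight t m)) (regularRight n τ))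
    (g := convMap (regularBimodule.obj ⟨Fin m⟩) (sgn t) (S := ⟨Fin n⟩) (T := ⟨Fin n⟩) τ ∘ₗ
      (tensorEquivConv n t m).toLinearMap)
    (tensor_ceRight_ext (N := RegularConv t m ⟨Fin n⟩) fun g => ?_) x
  obtain ⟨A, e, f, rfl⟩ := exists_glue g
  refine (congrArg (tensorEquivConv n t m) (tensorMap_regularRight τ _)).trans ?_
  refine Eq.trans ?_ (congrArg (convMap (regularBimodule.obj ⟨Fin m⟩) (sgn t)
    (S := ⟨Fin n⟩) (T := ⟨Fin n⟩) τ) (tensorEquivConv_permClass_glue A e f)).symm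
  refine Eq.trans ?_ (convMap_convClass (S := ⟨Fin n⟩) (T := ⟨Fin n⟩) τ A e f).symm
  rw [trans_glue]
  exact tensorEquivConv_permClass_glue _ _ _

/-- The terms of `CE ⊗_CatLie ℚ𝔖_n` are the bimodules `ℚ𝔖_m ⊙ sgn_t`. -/
def ceTermTensorIso (n t : ℕ) :
    permFunctor ⋙ ceTerm t ⋙ tensorWith (regular n) ≅
      regularConvSgn t ⋙ (evaluation _ _).obj (op (skeleton.obj ⟨n⟩)) :=
  NatIso.ofComponents (fun m => (tensorEquivConv n t m.n).toModuleIso) fun σ =>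
    ModuleCat.hom_ext (LinearMap.ext fun x => tensorEquivConv_natural σ x)

theorem ceTermTensorIso_right (n t m : ℕ) (τ : Equiv.Perm (Fin n)) :
    (tensorWithMap (regularRight n τ)).app (ceRight t m) ≫ (ceTermTensorIso n t).hom.app ⟨m⟩ =
      (ceTermTensorIso n t).hom.app ⟨m⟩ ≫ ((regularConvSgn t).obj ⟨m⟩).map
        (skeleton.map (X := ⟨n⟩) (Y := ⟨n⟩) τ).op :=
  ModuleCat.hom_ext (LinearMap.ext fun x => tensorEquivConv_right τ x)

end

end LieProp

/-! ### Assembly -/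

theorem mainTheorem8 (n t : ℕ) :
    (∀ {a b : LieProp.CatLie} (f : a ⟶ b), (LieProp.ceHomology n t).map f =
      (LieProp.ceHomology n t).map (LieProp.unit.map (LieProp.aug.map f))) ∧
    (∃ e : LieProp.permFunctor ⋙ LieProp.ceHomology n t ≅
        LieProp.regularConvSgn t ⋙ (evaluation _ _).obj (op (LieProp.skeleton.obj ⟨n⟩)),
      ∀ (m : ℕ) (τ : Equiv.Perm (Fin n)),
        (LieProp.ceHomologyRight n t τ).app (LieProp.permFunctor.obj ⟨m⟩) ≫ e.hom.app ⟨m⟩ =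
          e.hom.app ⟨m⟩ ≫ ((LieProp.regularConvSgn t).obj ⟨m⟩).map
            (LieProp.skeleton.map (X := ⟨n⟩) (Y := ⟨n⟩) τ).op) ∧
    ∀ m : ℕ, m + t ≠ n → Limits.IsZero ((LieProp.ceHomology n t).obj ⟨m⟩) := by
  -- By `augHom_unit`, `f` and its image in `CatLie` through `ℚΣ` have the same augmentation. The
  -- bimodule isomorphism is the composite of homology to term and term to convolution, each already
  -- compatible with the right action.
  refine ⟨fun {a b} f => LieProp.ceHomology_map_eq n t f _ (LieProp.augHom_unit _).symm,
    ⟨Functor.isoWhiskerLeft LieProp.permFunctor (LieProp.ceHomologyIso n t) ≪≫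
      LieProp.ceTermTensorIso n t, fun m τ => ?_⟩, LieProp.isZero_ceHomology n t⟩
  have h₁ := congrArg (fun α => α.app (LieProp.permFunctor.obj ⟨m⟩))
    (LieProp.ceHomologyRight_iso n t τ)
  have h₂ := LieProp.ceTermTensorIso_right n t m τ
  simp only [NatTrans.comp_app] at h₁
  simp only [Iso.trans_hom, NatTrans.comp_app, Functor.isoWhiskerLeft_hom,
    Functor.whiskerLeft_app, Category.assoc]
  rw [reassoc_of% h₁]
  exact congrArg ((LieProp.ceHomologyIso n t).hom.app (LieProp.permFunctor.obj ⟨m⟩) ≫ ·) h₂
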